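/- \textbf{Theorem (Necessary condition).} Let $m,n\ge 1$, let $\boldsymbol{k}=(k_1,\dots,k_m)$ with $1\le k_i\le n$, and write $\boldsymbol{\Lambda^{k}}=\prod_{i=1}^m\Lambda^{k_i}(\mathbb{R}^n)$ and $\boldsymbol{\Lambda^{k-1}}=\prod_{i=1}^m\Lambda^{k_i-1}(\mathbb{R}^n)$, where $\Lambda^{j}(\mathbb{R}^n)$ is the space of alternating $j$-linear forms on $\mathbb{R}^n$. For an open bounded set $U\subset\mathbb{R}^n$ let $W^{d,\boldsymbol{\infty}}(U;\boldsymbol{\Lambda^{k-1}})$ be the space of all $\boldsymbol{\omega}=(\omega_1,\dots,\omega_m)\in L^\infty(U;\boldsymbol{\Lambda^{k-1}})$ whose distributional exterior derivative $\boldsymbol{d\omega}=(d\omega_1,\dots,d\omega_m)$ is in $L^\infty(U;\boldsymbol{\Lambda^{k}})$; a sequence converges weakly $\ast$ in this space if the forms and their exterior derivatives converge weakly $\ast$ in $L^\infty$. Let $W^{d,\boldsymbol{\infty}}_T(U;\boldsymbol{\Lambda^{k-1}})$ be the subspace of those $\boldsymbol{\omega}$ whose tangential part vanishes on $\partial U$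 in the weak sense, i.e. $\int_U\psi\,d\omega_i=-\int_U d\psi\wedge\omega_i$ for every $i$ and every $\psi\in C_c^\infty(\mathbb{R}^n)$. Let $\Omega\subset\mathbb{R}^n$ be open and bounded, and let $f:\Omega\times\boldsymbol{\Lambda^{k-1}}\times\boldsymbol{\Lambda^{k}}\to\mathbb{R}$ be a Carath\'eodory function (measurable in $x$ for all $(\boldsymbol{\omega},\boldsymbol{\xi})$, continuous in $(\boldsymbol{\omega},\boldsymbol{\xi})$ for a.e. $x$) satisfying, for a.e. $x\in\Omega$ and all $(\boldsymbol{\omega},\boldsymbol{\xi})$, $$|f(x,\boldsymbol{\omega},\boldsymbol{\xi})|\le a(x)+b(\boldsymbol{\omega},\boldsymbol{\xi}),$$ where $a\in L^1(\mathbb{R}^n)$ and $b\in C(\boldsymbol{\Lambda^{k-1}}\times\boldsymbol{\Lambda^{k}})$ is non-negative. Suppose that the functional $$I(\boldsymbol{\omega})=\int_\Omega f(x,\boldsymbol{\omega}(x),\boldsymbol{d\omega}(x))\,dx,\qquad \boldsymbol{\omega}\in W^{d,\boldsymbol{\infty}}(\Omega;\boldsymbol{\Lambda^{k-1}}),$$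 is (sequentially) weakly $\ast$ lower semicontinuous in $W^{d,\boldsymbol{\infty}}(\Omega;\boldsymbol{\Lambda^{k-1}})$. Then, with $D=(0,1)^n$, for almost every $x_0\in\Omega$ and for all $\boldsymbol{\omega_0}\in\boldsymbol{\Lambda^{k-1}}$, $\boldsymbol{\xi_0}\in\boldsymbol{\Lambda^{k}}$ and $\boldsymbol{\phi}\in W^{d,\boldsymbol{\infty}}_T(D;\boldsymbol{\Lambda^{k-1}})$, $$\int_D f(x_0,\boldsymbol{\omega_0},\boldsymbol{\xi_0}+\boldsymbol{d\phi}(x))\,dx\ \ge\ f(x_0,\boldsymbol{\omega_0},\boldsymbol{\xi_0}).$$ In particular, for a.e. $x\in\Omega$ and every $\boldsymbol{\omega}\in\boldsymbol{\Lambda^{k-1}}$ the function $g=f(x,\boldsymbol{\omega},\cdot):\boldsymbol{\Lambda^{k}}\to\mathbb{R}$ is vectorially ext. quasiconvex: $g$ is Borel measurable and locally bounded, and for every non-empty bounded open set $U\subset\mathbb{R}^n$, every $\boldsymbol{\xi}\in\boldsymbol{\Lambda^{k}}$ and every $\boldsymbol{\omega'}\in W^{1,\infty}_0(U;\boldsymbol{\Lambda^{k-1}})=W^{1,\infty}\cap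 W^{1,1}_0$, $$\frac1{|U|}\int_U g(\boldsymbol{\xi}+\boldsymbol{d\omega'}(x))\,dx\ \ge\ g(\boldsymbol{\xi}).$$ -/

import Mathlib

open MeasureTheory Filter Topology Set
open scoped ENNReal

namespace ExtForms

/-- Euclidean space of dimension `n`. -/
abbrev E (n : ℕ) : Type := EuclideanSpace ℝ (Fin n)

/-- `Λ^k(ℝⁿ)`: the alternating `k`-linear forms on `ℝⁿ`. -/
abbrev Form (n k : ℕ) : Type := (E n) [⋀^Fin k]→L[ℝ] ℝ

/-- `Λ^k(ℝⁿ)` for a tuple `k = (k₁, …, k_m)`: the product of the spaces `Λ^{k_i}(ℝⁿ)`.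
All norms on this finite-dimensional space are equivalent. -/
abbrev Forms (n : ℕ) {m : ℕ} (k : Fin m → ℕ) : Type := (i : Fin m) → Form n (k i)

/-- `ψ` is a smooth real function with compact support in `ℝⁿ`. -/
def IsTest {n : ℕ} (ψ : E n → ℝ) : Prop :=
  ContDiff ℝ ((⊤ : ℕ∞) : WithTop ℕ∞) ψ ∧ HasCompactSupport ψ

/-- `∫_Ω ψ dω = - ∫_Ω dψ ∧ ω` for one scalar test function `ψ`, where `η` stands for `dω`,
tested on all tuples of vectors `v`. -/
def PartsIdentity {n r : ℕ} (Ω : Set (E n)) (ω : E n → Form n r) (η : E n → Form n (r + 1))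
    (ψ : E n → ℝ) : Prop :=
  ∀ v : Fin (r + 1) → E n,
    ∫ x in Ω, ψ x * η x v =
      - ∫ x in Ω, ∑ j : Fin (r + 1), (-1 : ℝ) ^ (j : ℕ) * fderiv ℝ ψ x (v j) * ω x (j.removeNth v)

/-- `η` is the exterior derivative of `ω` on `Ω` in the sense of distributions. -/
def HasWeakExtDeriv {n r : ℕ} (Ω : Set (E n)) (ω : E n → Form n r)
    (η : E n → Form n (r + 1)) : Prop :=
  ∀ ψ : E n → ℝ, IsTest ψ → tsupport ψ ⊆ Ω → PartsIdentity Ω ω η ψ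

/-- An element of `W^{d,∞}(Ω; Λ^r)`, `r = (r₁, …, r_m)`: a tuple of forms in `L^∞(Ω)` whose
weak exterior derivative is in `L^∞(Ω)`. Representatives of both are carried along;
`d` is determined by `form` up to a null set, see `WdInfty.d_ae_unique`. -/
structure WdInfty {n m : ℕ} (Ω : Set (E n)) (r : Fin m → ℕ) where
  /-- the tuple of forms `ω` -/
  form : E n → Forms n r
  /-- its weak exterior derivative `dω` -/
  d : E n → Forms n (fun i => r i + 1)
  memLp_form : MemLp form ∞ (volume.restrict Ω)
  memLp_d : MemLp d ∞ (volume.restrict Ω)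
  isWeak : ∀ i, HasWeakExtDeriv Ω (fun x => form x i) (fun x => d x i)

/-- The weak exterior derivative is unique almost everywhere. -/
theorem WdInfty.d_ae_unique {n m : ℕ} {Ω : Set (E n)} (hΩ : IsOpen Ω) {r : Fin m → ℕ}
    (u w : WdInfty Ω r) (h : u.form =ᵐ[volume.restrict Ω] w.form) :
    u.d =ᵐ[volume.restrict Ω] w.d := by
  have hloc : LocallyIntegrableOn (fun x => u.d x - w.d x) Ω := by
    refine (locallyIntegrableOn_iff hΩ.isLocallyClosed).2 fun K hK hc => ?_
    have hm : MemLp (fun x => u.d x - w.d x) ∞ (volume.restrict K) :=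
      (u.memLp_d.sub w.memLp_d).mono_measure (Measure.restrict_mono hK le_rfl)
    have : IsFiniteMeasure (volume.restrict K) :=
      ⟨by simpa using hc.measure_lt_top⟩
    exact hm.integrable le_top
  have key : ∀ᵐ x, x ∈ Ω → u.d x - w.d x = 0 := by
    refine hΩ.ae_eq_zero_of_integral_contDiff_smul_eq_zero hloc fun g hg hgc hgs => ?_
    have hgint : ∀ F : E n → Forms n (fun i => r i + 1), MemLp F ∞ (volume.restrict Ω) →
        Integrable (fun x => g x • F x) (volume.restrict Ω) := fun F hF =>
      ((hg.continuous.integrable_of_hasCompactSupport hgc).restrict).smul_of_top_left hF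
    have hout : ∫ x, g x • (u.d x - w.d x) = ∫ x in Ω, g x • (u.d x - w.d x) := by
      refine (setIntegral_eq_integral_of_forall_compl_eq_zero fun x hx => ?_).symm
      rw [image_eq_zero_of_notMem_tsupport fun hx' => hx (hgs hx'), zero_smul]
    rw [hout]
    have hs : (fun x => g x • (u.d x - w.d x)) = fun x => g x • u.d x - g x • w.d x := by
      funext x; rw [smul_sub]
    rw [hs, integral_sub (hgint _ u.memLp_d) (hgint _ w.memLp_d), sub_eq_zero]
    funext i
    ext v
    let L : Forms n (fun i => r i + 1) →L[ℝ] ℝ :=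
      (ContinuousAlternatingMap.apply ℝ (E n) ℝ v).comp (ContinuousLinearMap.proj i)
    have e1 := L.integral_comp_comm (hgint _ u.memLp_d)
    have e2 := L.integral_comp_comm (hgint _ w.memLp_d)
    change L _ = L _
    rw [← e1, ← e2]
    have p1 := u.isWeak i g ⟨hg, hgc⟩ hgs v
    have p2 := w.isWeak i g ⟨hg, hgc⟩ hgs v
    change ∫ x in Ω, g x * u.d x i v = ∫ x in Ω, g x * w.d x i v
    rw [p1, p2]
    congr 1
    refine integral_congr_ae ?_
    filter_upwards [h] with x hx
    rw [hx]
  filter_upwards [(ae_restrict_iff' hΩ.measurableSet).2 key] with x hx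
  exact sub_eq_zero.1 hx

/-- `ω` has zero tangential part on `∂Ω` (`ν ∧ ω = 0`) in the weak sense: the integration by
parts formula has no boundary term, also for test functions which do not vanish near `∂Ω`.
These `ω` form the space `W_T^{d,∞}(Ω; Λ^r)`. -/
def WdInfty.ZeroTangential {n m : ℕ} {Ω : Set (E n)} {r : Fin m → ℕ} (ω : WdInfty Ω r) : Prop :=
  ∀ i, ∀ ψ : E n → ℝ, IsTest ψ → PartsIdentity Ω (fun x => ω.form x i) (fun x => ω.d x i) ψ

/-- Weak-* convergence in `L^∞(Ω; F) = L¹(Ω; F*)*`, for a finite-dimensional space `F`. -/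
def WeakStarTendstoLinfty {n : ℕ} {F : Type*} [NormedAddCommGroup F] [NormedSpace ℝ F]
    (Ω : Set (E n)) (u : ℕ → E n → F) (u₀ : E n → F) : Prop :=
  ∀ g : E n → (F →L[ℝ] ℝ), IntegrableOn g Ω →
    Tendsto (fun ν => ∫ x in Ω, g x (u ν x)) atTop (𝓝 (∫ x in Ω, g x (u₀ x)))

/-- Weak-* convergence in `W^{d,∞}(Ω; Λ^r)`: weak-* convergence in `L^∞` of the forms and of
their exterior derivatives. -/
def WdInfty.WeakStarTendsto {n m : ℕ} {Ω : Set (E n)} {r : Fin m → ℕ}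
    (u : ℕ → WdInfty Ω r) (u₀ : WdInfty Ω r) : Prop :=
  WeakStarTendstoLinfty Ω (fun ν => (u ν).form) u₀.form ∧
    WeakStarTendstoLinfty Ω (fun ν => (u ν).d) u₀.d

/-- (Sequential) weak-* lower semicontinuity of a functional on `W^{d,∞}(Ω; Λ^r)`. -/
def WeakStarLSC {n m : ℕ} {Ω : Set (E n)} {r : Fin m → ℕ} (I : WdInfty Ω r → ℝ) : Prop :=
  ∀ (u : ℕ → WdInfty Ω r) (u₀ : WdInfty Ω r), WdInfty.WeakStarTendsto u u₀ →
    (I u₀ : EReal) ≤ liminf (fun ν => (I (u ν) : EReal)) atTop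

/-- `f : Ω × X → ℝ` is a Carathéodory function: Lebesgue measurable in `x ∈ Ω` for every second
argument, and continuous in the second argument for almost every `x ∈ Ω`. -/
def IsCaratheodory {n : ℕ} {X : Type*} [TopologicalSpace X] (Ω : Set (E n))
    (f : E n → X → ℝ) : Prop :=
  (∀ z, AEMeasurable (fun x => f x z) (volume.restrict Ω)) ∧
    ∀ᵐ x ∂(volume.restrict Ω), Continuous (f x)

/-- `G` is the weak gradient of `u` on `Ω`. -/
def HasWeakGrad {n : ℕ} {F : Type*} [NormedAddCommGroup F] [NormedSpace ℝ F] (Ω : Set (E n))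
    (u : E n → F) (G : E n → (E n →L[ℝ] F)) : Prop :=
  ∀ ψ : E n → ℝ, IsTest ψ → tsupport ψ ⊆ Ω → ∀ v : E n,
    ∫ x in Ω, ψ x • G x v = - ∫ x in Ω, (fderiv ℝ ψ x v) • u x

/-- `u ∈ W_0^{1,∞}(Ω; F) = W^{1,∞}(Ω; F) ∩ W_0^{1,1}(Ω; F)`, where `W_0^{1,1}` is the closure of
the smooth functions with compact support in `Ω` for the `W^{1,1}` norm. -/
def MemW0 {n : ℕ} {F : Type*} [NormedAddCommGroup F] [NormedSpace ℝ F] (Ω : Set (E n))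
    (u : E n → F) : Prop :=
  MemLp u ∞ (volume.restrict Ω) ∧
  ∃ G : E n → (E n →L[ℝ] F), MemLp G ∞ (volume.restrict Ω) ∧ HasWeakGrad Ω u G ∧
    ∃ θ : ℕ → E n → F,
      (∀ j, ContDiff ℝ ((⊤ : ℕ∞) : WithTop ℕ∞) (θ j) ∧ HasCompactSupport (θ j) ∧ tsupport (θ j) ⊆ Ω) ∧
      Tendsto (fun j => eLpNorm (fun x => θ j x - u x) 1 (volume.restrict Ω)) atTop (𝓝 0) ∧
      Tendsto (fun j => eLpNorm (fun x => fderiv ℝ (θ j) x - G x) 1 (volume.restrict Ω))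
        atTop (𝓝 0)

/-- Vectorial ext. quasiconvexity of `f : Λ^k → ℝ`, with `k_i = r_i + 1`. The empty domain, for
which the mean value makes no sense, is left out. (A tuple in `W_0^{1,∞}` is in `W^{d,∞}`, so the
quantifier runs over all of `W_0^{1,∞}(Ω; Λ^{k-1})`.) -/
def VectExtQuasiconvex {n m : ℕ} {r : Fin m → ℕ}
    (f : Forms n (fun i => r i + 1) → ℝ) : Prop :=
  Measurable[borel (Forms n (fun i => r i + 1))] f ∧
  (∀ ξ, ∃ U ∈ 𝓝 ξ, ∃ C : ℝ, ∀ η ∈ U, |f η| ≤ C) ∧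
  ∀ Ω : Set (E n), IsOpen Ω → Bornology.IsBounded Ω → Ω.Nonempty →
    ∀ (ξ : Forms n (fun i => r i + 1)) (ω : WdInfty Ω r), MemW0 Ω ω.form →
      f ξ ≤ (volume.real Ω)⁻¹ * ∫ x in Ω, f (ξ + ω.d x)

/-- The open unit cube `(0,1)ⁿ`. -/
def unitCube (n : ℕ) : Set (E n) := {x | ∀ i, x i ∈ Ioo (0 : ℝ) 1}

/-- The functional `I(ω) = ∫_Ω f(x, ω(x), dω(x)) dx` on `W^{d,∞}(Ω; Λ^r)`. -/
noncomputable def energy {n m : ℕ} (Ω : Set (E n)) (r : Fin m → ℕ)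
    (f : E n → Forms n r × Forms n (fun i => r i + 1) → ℝ) (ω : WdInfty Ω r) : ℝ :=
  ∫ x in Ω, f x (ω.form x, ω.d x)

end ExtForms

/-! The inequality comes from testing lower semicontinuity on fine oscillations. Fix ω₁, ξ₀ and a
test form φ on D. The affine form ω(x) = ω₁ + ι_x ξ₀/(r+1) has dω = ξ₀, and φ, having no tangential
part on ∂D, extends by zero to ℝⁿ. For an open U ⊆ Ω, place copies s⁻¹ φ(s x + y - z) in the lattice
cells of side 1/s contained in U. They are O(1/s) uniformly and their exterior derivatives stay
bounded, so they tend to zero weakly-* (`weakStarTendsto_addGlobal`).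

No limit of the oscillating energies is computed. By Fubini and periodicity, the mean over the phase
y of ∫_U f(x, ω(x), ξ₀ + dφ(s x + y)), with dφ made periodic, is exactly ∫_U ∫_D f(x, ω(x), ξ₀ +
dφ(y)) dy dx. Hence for each s some phase does no worse (`exists_phase_integral_le`). The incomplete
cells near ∂U and the small change of ω are negligible by dominated convergence, which gives
`setIntegral_le_setIntegral_average`. Since U is arbitrary, the integrands compare almost everywhere
(`ae_le_average`).

The null set still depends on (ω₁, ξ₀, φ). Because L¹(D) is separable, countably many triples
suffice, and continuity of f(x, ·) extends the inequality to all of them. At a given x₀ the choice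
ω₁ = ω₀ - ι_{x₀} ξ₀/(r+1) reaches any prescribed value ω₀ (`ae_forall_le_average`).

For quasiconvexity on a general domain, a form in W_0^{1,∞} has zero tangential part, so its
extension by zero can be shrunk into D by a homothety. The excess g(ξ + dω) - g(ξ) vanishes off the
domain, and its integral only changes by a positive factor. -/

namespace ExtForms

/-! ### Coordinates on tuples of alternating forms -/

section Coordinates

variable {n m : ℕ}

/-- Evaluation of the `i`-th component of a tuple of forms at the vectors `v`. -/
noncomputable def evalForm (k : Fin m → ℕ) (i : Fin m) (v : Fin (k i) → E n) :
    Forms n k →L[ℝ] ℝ :=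
  (ContinuousAlternatingMap.apply ℝ (E n) ℝ v).comp (ContinuousLinearMap.proj i)

@[simp] theorem evalForm_apply (k : Fin m → ℕ) (i : Fin m) (v : Fin (k i) → E n)
    (η : Forms n k) : evalForm k i v η = η i v := rfl

/-- The coefficients of a tuple of forms with respect to the standard basis. -/
noncomputable def coeffs (n : ℕ) {m : ℕ} (k : Fin m → ℕ) :
    Forms n k →ₗ[ℝ] ((p : Σ i, Fin (k i) → Fin n) → ℝ) where
  toFun η p := η p.1 fun j => EuclideanSpace.basisFun (Fin n) ℝ (p.2 j)
  map_add' _ _ := rfl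
  map_smul' _ _ := rfl

theorem coeffs_injective (k : Fin m → ℕ) : Function.Injective (coeffs n k) := by
  intro η ζ h
  funext i
  apply ContinuousAlternatingMap.toAlternatingMap_injective
  refine Module.Basis.ext_alternating (EuclideanSpace.basisFun (Fin n) ℝ).toBasis fun v _ => ?_
  simpa [coeffs] using congrFun h ⟨i, v⟩

instance Forms.finiteDimensional (k : Fin m → ℕ) : FiniteDimensional ℝ (Forms n k) :=
  FiniteDimensional.of_injective (coeffs n k) (coeffs_injective k)

instance Forms.properSpace (k : Fin m → ℕ) : ProperSpace (Forms n k) :=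
  FiniteDimensional.proper ℝ _

instance Forms.secondCountableTopology (k : Fin m → ℕ) :
    SecondCountableTopology (Forms n k) := secondCountable_of_proper

/-- A linear left inverse of the injective coefficient map supplies the c p. They need not be a
basis, since p runs over all index tuples and not only the increasing ones. The expansion reduces
weak-* convergence of forms to scalar integrals. -/
theorem exists_frame (k : Fin m → ℕ) : ∃ c : (Σ i, Fin (k i) → Fin n) → Forms n k,
    ∀ η : Forms n k,
      η = ∑ p, η p.1 (fun j => EuclideanSpace.basisFun (Fin n) ℝ (p.2 j)) • c p := by
  obtain ⟨S, hS⟩ := (coeffs n k).exists_leftInverse_of_injective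
    (LinearMap.ker_eq_bot.2 (coeffs_injective k))
  refine ⟨fun p => S (Pi.single p 1), fun η => ?_⟩
  have h1 : S (coeffs n k η) = η := by
    simpa using LinearMap.congr_fun hS η
  conv_lhs => rw [← h1, pi_eq_sum_univ' (coeffs n k η), map_sum]
  refine Finset.sum_congr rfl fun p _ => ?_
  rw [map_smul]
  rfl

end Coordinates

/-! ### Integrability of the terms in the integration by parts formula -/

section Integrability

variable {n m : ℕ} {k : Fin m → ℕ} {μ : Measure (E n)}

theorem integrable_mul_form {g : E n → ℝ} (hg : Integrable g μ) {F : E n → Forms n k}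
    (hF : MemLp F ∞ μ) (i : Fin m) (v : Fin (k i) → E n) :
    Integrable (fun x => g x * F x i v) μ := by
  have h : Integrable (fun x => g x • F x) μ := hg.smul_of_top_left hF
  exact (evalForm k i v).integrable_comp h

theorem memLp_top_of_forall_norm_le {V : Type*} [NormedAddCommGroup V] {u : E n → V}
    (hu : StronglyMeasurable u) {C : ℝ} (hC : ∀ x, ‖u x‖ ≤ C) : MemLp u ∞ μ :=
  memLp_top_of_bound hu.aestronglyMeasurable C (Eventually.of_forall hC)

theorem IsTest.integrable {ψ : E n → ℝ} (h : IsTest ψ) : Integrable ψ :=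
  h.1.continuous.integrable_of_hasCompactSupport h.2

theorem IsTest.integrable_fderiv {ψ : E n → ℝ} (h : IsTest ψ) (v : E n) :
    Integrable (fun x => fderiv ℝ ψ x v) := by
  refine Continuous.integrable_of_hasCompactSupport ?_ (h.2.fderiv_apply ℝ v)
  exact (h.1.continuous_fderiv (by simp)).clm_apply continuous_const

theorem integrable_parts_sum {r : Fin m → ℕ} {ψ : E n → ℝ}
    (hψ : ∀ v, Integrable (fun x => fderiv ℝ ψ x v) μ)
    {u : E n → Forms n r} (hu : MemLp u ∞ μ) (i : Fin m) (v : Fin (r i + 1) → E n) :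
    Integrable (fun x => ∑ j : Fin (r i + 1),
      (-1 : ℝ) ^ (j : ℕ) * fderiv ℝ ψ x (v j) * u x i (j.removeNth v)) μ :=
  integrable_finsetSum _ fun j _ =>
    integrable_mul_form ((hψ (v j)).const_mul _) hu i _

end Integrability

/-! ### Forms on the whole space: sums, rescaling, extension by zero -/

/-- A bounded measurable tuple of forms on `ℝⁿ` together with its bounded weak exterior
derivative. -/
structure IsGlobalPair {n m : ℕ} {r : Fin m → ℕ} (u : E n → Forms n r)
    (w : E n → Forms n (fun i => r i + 1)) : Prop where
  meas_form : StronglyMeasurable u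
  meas_d : StronglyMeasurable w
  bdd_form : ∃ C : ℝ, ∀ x, ‖u x‖ ≤ C
  bdd_d : ∃ C : ℝ, ∀ x, ‖w x‖ ≤ C
  parts : ∀ i, ∀ ψ : E n → ℝ, IsTest ψ →
    PartsIdentity univ (fun x => u x i) (fun x => w x i) ψ

theorem partsIdentity_of_eq_zero {n q : ℕ} {S : Set (E n)} {u : E n → Form n q}
    {w : E n → Form n (q + 1)} {ψ : E n → ℝ} (hu : ∀ x, x ∉ S → u x = 0)
    (hw : ∀ x, x ∉ S → w x = 0) : PartsIdentity univ u w ψ ↔ PartsIdentity S u w ψ := by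
  unfold PartsIdentity
  refine forall_congr' fun v => ?_
  rw [Measure.restrict_univ, setIntegral_eq_integral_of_forall_compl_eq_zero,
    setIntegral_eq_integral_of_forall_compl_eq_zero]
  · intro x hx; simp [hu x hx]
  · intro x hx; simp [hw x hx]

theorem PartsIdentity.add {n m : ℕ} {S : Set (E n)} {r : Fin m → ℕ} {u u' : E n → Forms n r}
    {w w' : E n → Forms n (fun i => r i + 1)} {i : Fin m} {ψ : E n → ℝ} (hψ : IsTest ψ)
    (hu : MemLp u ∞ (volume.restrict S)) (hw : MemLp w ∞ (volume.restrict S))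
    (hu' : MemLp u' ∞ (volume.restrict S)) (hw' : MemLp w' ∞ (volume.restrict S))
    (h : PartsIdentity S (fun x => u x i) (fun x => w x i) ψ)
    (h' : PartsIdentity S (fun x => u' x i) (fun x => w' x i) ψ) :
    PartsIdentity S (fun x => (u + u') x i) (fun x => (w + w') x i) ψ := by
  intro v
  have e := h v
  have e' := h' v
  have hd := fun v => (hψ.integrable_fderiv v).restrict (s := S)
  have e1 := integral_add (integrable_mul_form hψ.integrable.restrict hw i v)
    (integrable_mul_form hψ.integrable.restrict hw' i v)
  have e2 := integral_add (integrable_parts_sum hd hu i v) (integrable_parts_sum hd hu' i v)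
  simp only [Pi.add_apply, ContinuousAlternatingMap.add_apply, mul_add, Finset.sum_add_distrib]
  rw [e1, e2, e, e']
  ring

namespace IsGlobalPair

variable {n m : ℕ} {r : Fin m → ℕ} {u u' : E n → Forms n r}
  {w w' : E n → Forms n (fun i => r i + 1)}

theorem memLp_form (h : IsGlobalPair u w) (μ : Measure (E n)) : MemLp u ∞ μ := by
  obtain ⟨C, hC⟩ := h.bdd_form
  exact memLp_top_of_forall_norm_le h.meas_form hC

theorem memLp_d (h : IsGlobalPair u w) (μ : Measure (E n)) : MemLp w ∞ μ := by
  obtain ⟨C, hC⟩ := h.bdd_d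
  exact memLp_top_of_forall_norm_le h.meas_d hC

protected theorem zero : IsGlobalPair (0 : E n → Forms n r) 0 where
  meas_form := stronglyMeasurable_zero
  meas_d := stronglyMeasurable_zero
  bdd_form := ⟨0, by simp⟩
  bdd_d := ⟨0, by simp⟩
  parts i ψ _ v := by simp

protected theorem add (h : IsGlobalPair u w) (h' : IsGlobalPair u' w') :
    IsGlobalPair (u + u') (w + w') where
  meas_form := h.meas_form.add h'.meas_form
  meas_d := h.meas_d.add h'.meas_d
  bdd_form := by
    obtain ⟨C, hC⟩ := h.bdd_form
    obtain ⟨C', hC'⟩ := h'.bdd_form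
    exact ⟨C + C', fun x => norm_add_le_of_le (hC x) (hC' x)⟩
  bdd_d := by
    obtain ⟨C, hC⟩ := h.bdd_d
    obtain ⟨C', hC'⟩ := h'.bdd_d
    exact ⟨C + C', fun x => norm_add_le_of_le (hC x) (hC' x)⟩
  parts i ψ hψ := PartsIdentity.add hψ (h.memLp_form _) (h.memLp_d _) (h'.memLp_form _)
    (h'.memLp_d _) (h.parts i ψ hψ) (h'.parts i ψ hψ)

protected theorem sum {ι : Type*} (Z : Finset ι) {U : ι → E n → Forms n r}
    {W : ι → E n → Forms n (fun i => r i + 1)} (h : ∀ z ∈ Z, IsGlobalPair (U z) (W z)) :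
    IsGlobalPair (∑ z ∈ Z, U z) (∑ z ∈ Z, W z) := by
  classical
  induction Z using Finset.induction_on with
  | empty => simpa using IsGlobalPair.zero
  | insert a s ha ih =>
    rw [Finset.sum_insert ha, Finset.sum_insert ha]
    exact (h a (Finset.mem_insert_self a s)).add
      (ih fun z hz => h z (Finset.mem_insert_of_mem hz))

theorem _root_.ExtForms.integral_comp_affine {s : ℝ} (c : E n) {V : Type*}
    [NormedAddCommGroup V] [NormedSpace ℝ V] (F : E n → V) :
    ∫ x, F (s • x + c) = |(s ^ Module.finrank ℝ (E n))⁻¹| • ∫ x, F x := by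
  rw [Measure.integral_comp_smul volume (fun y => F (y + c)) s, integral_add_right_eq_self]

theorem _root_.ExtForms.IsTest.comp_affine {ψ : E n → ℝ} (hψ : IsTest ψ) {s : ℝ} (hs : s ≠ 0)
    (c : E n) : IsTest (fun y => ψ (s⁻¹ • (y - c))) := by
  refine ⟨hψ.1.comp ((contDiff_id.sub contDiff_const).const_smul _), ?_⟩
  exact hψ.2.comp_homeomorph
    ((Homeomorph.subRight c).trans (Homeomorph.smulOfNeZero s⁻¹ (inv_ne_zero hs)))

/-- The factor s⁻¹ absorbs the factor s of the chain rule, so the derivative keeps its size while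
the form becomes small for large s. Weakly, this is the identity for (u, w) tested on ψ(s⁻¹(y - c)),
followed by a change of variables whose Jacobian appears on both sides. -/
theorem comp_affine (h : IsGlobalPair u w) {s : ℝ} (hs : s ≠ 0) (c : E n) :
    IsGlobalPair (fun x => s⁻¹ • u (s • x + c)) (fun x => w (s • x + c)) where
  meas_form := (h.meas_form.comp_measurable
    (show Measurable fun x : E n => s • x + c by fun_prop)).fun_const_smul _
  meas_d := h.meas_d.comp_measurable (show Measurable fun x : E n => s • x + c by fun_prop)
  bdd_form := by
    obtain ⟨C, hC⟩ := h.bdd_form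
    refine ⟨|s⁻¹| * C, fun x => ?_⟩
    rw [norm_smul, Real.norm_eq_abs]
    exact mul_le_mul_of_nonneg_left (hC _) (abs_nonneg _)
  bdd_d := by
    obtain ⟨C, hC⟩ := h.bdd_d
    exact ⟨C, fun x => hC _⟩
  parts i ψ hψ v := by
    have e := h.parts i _ (hψ.comp_affine hs c) v
    have hd : ∀ y z : E n, fderiv ℝ (fun y => ψ (s⁻¹ • (y - c))) (s • y + c) z
        = s⁻¹ * fderiv ℝ ψ y z := by
      intro y z
      have h1 : HasFDerivAt (fun y : E n => s⁻¹ • (y - c))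
          (s⁻¹ • ContinuousLinearMap.id ℝ (E n)) (s • y + c) :=
        ((hasFDerivAt_id _).sub_const c).const_smul s⁻¹
      have h2 : HasFDerivAt ψ (fderiv ℝ ψ y) (s⁻¹ • (s • y + c - c)) := by
        rw [add_sub_cancel_right, inv_smul_smul₀ hs]
        exact (hψ.1.differentiable (by simp)).differentiableAt.hasFDerivAt
      have h3 := HasFDerivAt.comp (s • y + c) h2 h1
      have h4 := h3.fderiv
      simp only [Function.comp_def] at h4
      rw [h4]
      simp
    simp only [Measure.restrict_univ] at e ⊢
    have e1 := integral_comp_affine (s := s) c (fun y => ψ (s⁻¹ • (y - c)) * w y i v)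
    have e2 := integral_comp_affine (s := s) c (fun y => ∑ j : Fin (r i + 1), (-1 : ℝ) ^ (j : ℕ) *
      fderiv ℝ (fun y => ψ (s⁻¹ • (y - c))) y (v j) * u y i (j.removeNth v))
    simp only [hd, add_sub_cancel_right, inv_smul_smul₀ hs] at e1 e2
    rw [e1, e, smul_neg, ← e2]
    congr 1
    refine integral_congr_ae (Eventually.of_forall fun x => Finset.sum_congr rfl fun j _ => ?_)
    simp only [Pi.smul_apply, ContinuousAlternatingMap.smul_apply, smul_eq_mul]
    ring

end IsGlobalPair

theorem WdInfty.hasWeakExtDeriv_add_global {n m : ℕ} {Ω : Set (E n)} {r : Fin m → ℕ}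
    (u₀ : WdInfty Ω r) {u : E n → Forms n r} {w : E n → Forms n (fun i => r i + 1)}
    (h : IsGlobalPair u w) (hu : ∀ x, x ∉ Ω → u x = 0) (hw : ∀ x, x ∉ Ω → w x = 0) (i : Fin m) :
    HasWeakExtDeriv Ω (fun x => (u₀.form + u) x i) (fun x => (u₀.d + w) x i) := by
  intro ψ hψ hs
  have e := (partsIdentity_of_eq_zero (S := Ω) (u := fun x => u x i) (w := fun x => w x i)
    (fun x hx => congrFun (hu x hx) i) (fun x hx => congrFun (hw x hx) i)).1 (h.parts i ψ hψ)
  have e₀ := u₀.isWeak i ψ hψ hs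
  have m1 := h.memLp_form (volume.restrict Ω)
  have m2 := h.memLp_d (volume.restrict Ω)
  exact PartsIdentity.add hψ u₀.memLp_form u₀.memLp_d m1 m2 e₀ e

/-- The sum of an element of `W^{d,∞}(Ω)` and a global pair that vanishes outside `Ω`. -/
def WdInfty.addGlobal {n m : ℕ} {Ω : Set (E n)} {r : Fin m → ℕ} (u₀ : WdInfty Ω r)
    {u : E n → Forms n r} {w : E n → Forms n (fun i => r i + 1)} (h : IsGlobalPair u w)
    (hu : ∀ x, x ∉ Ω → u x = 0) (hw : ∀ x, x ∉ Ω → w x = 0) : WdInfty Ω r where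
  form := u₀.form + u
  d := u₀.d + w
  memLp_form := MemLp.add (f := u₀.form) (g := u) u₀.memLp_form (h.memLp_form _)
  memLp_d := MemLp.add (f := u₀.d) (g := w) u₀.memLp_d (h.memLp_d _)
  isWeak := u₀.hasWeakExtDeriv_add_global h hu hw

theorem exists_ae_norm_le {α V : Type*} [MeasurableSpace α] [NormedAddCommGroup V]
    {μ : Measure α} {u : α → V} (hu : MemLp u ∞ μ) : ∃ N : ℕ, ∀ᵐ x ∂μ, ‖u x‖ ≤ N := by
  have hfin : eLpNormEssSup u μ ≠ ∞ := by simpa using hu.eLpNorm_ne_top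
  obtain ⟨N, hN⟩ := exists_nat_ge (eLpNormEssSup u μ).toReal
  refine ⟨N, ?_⟩
  filter_upwards [ae_le_eLpNormEssSup (f := u) (μ := μ)] with x hx
  rw [← toReal_enorm]
  exact (ENNReal.toReal_mono hfin hx).trans hN

/-- The measurable, everywhere bounded representative, extended by zero, of an `L^∞` function. -/
theorem exists_bounded_extension {n : ℕ} {V : Type*} [NormedAddCommGroup V] {S : Set (E n)}
    (hS : MeasurableSet S) {u : E n → V} (hu : MemLp u ∞ (volume.restrict S)) :
    ∃ u' : E n → V, StronglyMeasurable u' ∧ (∃ C : ℝ, ∀ x, ‖u' x‖ ≤ C) ∧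
      (∀ x, x ∉ S → u' x = 0) ∧ u' =ᵐ[volume.restrict S] u := by
  obtain ⟨C, hC⟩ := exists_ae_norm_le hu
  have hm := hu.aestronglyMeasurable.stronglyMeasurable_mk
  set v := hu.aestronglyMeasurable.mk u with hv
  have hA : MeasurableSet {x | ‖v x‖ ≤ (C : ℝ)} := hm.norm.measurable measurableSet_Iic
  refine ⟨(S ∩ {x | ‖v x‖ ≤ (C : ℝ)}).indicator v, hm.indicator (hS.inter hA), ⟨max C 0, fun x => ?_⟩,
    fun x hx => indicator_of_notMem (fun h => hx h.1) _, ?_⟩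
  · by_cases hx : x ∈ S ∩ {x | ‖v x‖ ≤ (C : ℝ)}
    · rw [indicator_of_mem hx]; exact le_max_of_le_left hx.2
    · rw [indicator_of_notMem hx]; simp
  · filter_upwards [hu.aestronglyMeasurable.ae_eq_mk, hC, ae_restrict_mem hS] with x h1 h2 h3
    change u x = v x at h1
    rw [indicator_of_mem, ← h1]
    exact ⟨h3, by rw [mem_ofPred_eq, ← h1]; exact h2⟩

/-- A form with vanishing tangential part can be extended by zero. -/
theorem WdInfty.ZeroTangential.exists_extension {n m : ℕ} {S : Set (E n)} {r : Fin m → ℕ}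
    (hS : MeasurableSet S) {φ : WdInfty S r} (h : φ.ZeroTangential) :
    ∃ (u : E n → Forms n r) (w : E n → Forms n (fun i => r i + 1)), IsGlobalPair u w ∧
      (∀ x, x ∉ S → u x = 0) ∧ (∀ x, x ∉ S → w x = 0) ∧
      w =ᵐ[volume.restrict S] φ.d := by
  obtain ⟨u, um, ub, u0, ue⟩ := exists_bounded_extension hS φ.memLp_form
  obtain ⟨w, wm, wb, w0, we⟩ := exists_bounded_extension hS φ.memLp_d
  refine ⟨u, w, ⟨um, wm, ub, wb, fun i ψ hψ => ?_⟩, u0, w0, we⟩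
  rw [partsIdentity_of_eq_zero (S := S) (fun x hx => by simp [u0 x hx])
    (fun x hx => by simp [w0 x hx])]
  intro v
  have e := h i ψ hψ v
  have e1 : ∫ x in S, ψ x * w x i v = ∫ x in S, ψ x * φ.d x i v :=
    integral_congr_ae (by filter_upwards [we] with x hx; rw [hx])
  rw [e1, e]
  congr 1
  exact integral_congr_ae (by filter_upwards [ue] with x hx; rw [hx])

/-! ### Weak-* convergence of uniformly small perturbations -/

section WeakStar

variable {n m : ℕ} {r : Fin m → ℕ} {u : ℕ → E n → Forms n r}
  {w : ℕ → E n → Forms n (fun i => r i + 1)}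

theorem norm_eval_le {k : Fin m → ℕ} (η : Forms n k) (i : Fin m) (v : Fin (k i) → E n) :
    |η i v| ≤ ‖η‖ * ∏ j, ‖v j‖ :=
  ((η i).le_opNorm v).trans
    (mul_le_mul_of_nonneg_right (norm_le_pi_norm η i) (Finset.prod_nonneg fun _ _ => norm_nonneg _))

/-- Integration by parts moves the derivative onto ψ, leaving only the uniformly small u ν. -/
theorem tendsto_integral_test_mul (h : ∀ ν, IsGlobalPair (u ν) (w ν)) {ε : ℕ → ℝ}
    (hε : Tendsto ε atTop (𝓝 0)) (hu : ∀ ν x, ‖u ν x‖ ≤ ε ν) (i : Fin m) (v : Fin (r i + 1) → E n)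
    {ψ : E n → ℝ} (hψ : IsTest ψ) :
    Tendsto (fun ν => ∫ x, ψ x * w ν x i v) atTop (𝓝 0) := by
  set G : E n → ℝ := fun x => ∑ j : Fin (r i + 1),
    |fderiv ℝ ψ x (v j)| * ∏ l, ‖j.removeNth v l‖ with hG
  have hGi : Integrable G :=
    integrable_finsetSum _ fun j _ => (hψ.integrable_fderiv (v j)).abs.mul_const _
  have key : ∀ ν, ‖∫ x, ψ x * w ν x i v‖ ≤ ε ν * ∫ x, G x := by
    intro ν
    have e := (h ν).parts i ψ hψ v
    simp only [Measure.restrict_univ] at e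
    rw [e, norm_neg, ← integral_const_mul]
    refine norm_integral_le_of_norm_le (hGi.const_mul _) (Eventually.of_forall fun x => ?_)
    rw [hG, Finset.mul_sum]
    refine (norm_sum_le _ _).trans (Finset.sum_le_sum fun j _ => ?_)
    rw [norm_mul, norm_mul, norm_pow, norm_neg, norm_one, one_pow, one_mul, Real.norm_eq_abs,
      Real.norm_eq_abs]
    have h1 : |u ν x i (j.removeNth v)| ≤ ε ν * ∏ l, ‖j.removeNth v l‖ :=
      (norm_eval_le (u ν x) i _).trans
        (mul_le_mul_of_nonneg_right (hu ν x) (Finset.prod_nonneg fun _ _ => norm_nonneg _))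
    calc _ ≤ |fderiv ℝ ψ x (v j)| * (ε ν * ∏ l, ‖j.removeNth v l‖) :=
          mul_le_mul_of_nonneg_left h1 (abs_nonneg _)
      _ = _ := by ring
  refine squeeze_zero_norm key ?_
  simpa using hε.mul_const (∫ x, G x)

/-- Test functions are dense in L¹, and the uniform bound on w ν controls the approximation error
independently of ν. -/
theorem tendsto_integral_mul_eval (h : ∀ ν, IsGlobalPair (u ν) (w ν)) {ε : ℕ → ℝ}
    (hε : Tendsto ε atTop (𝓝 0)) (hu : ∀ ν x, ‖u ν x‖ ≤ ε ν) {C : ℝ} (hw : ∀ ν x, ‖w ν x‖ ≤ C)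
    (i : Fin m) (v : Fin (r i + 1) → E n) {g : E n → ℝ} (hg : Integrable g) :
    Tendsto (fun ν => ∫ x, g x * w ν x i v) atTop (𝓝 0) := by
  have hC : 0 ≤ C := (norm_nonneg _).trans (hw 0 0)
  set M : ℝ := C * ∏ j, ‖v j‖ with hM
  have hM0 : 0 ≤ M := mul_nonneg hC (Finset.prod_nonneg fun _ _ => norm_nonneg _)
  rw [Metric.tendsto_atTop]
  intro δ hδ
  -- M bounds |w ν x i v|, so this L¹ tolerance costs at most δ/2; the summand 1 allows M = 0.
  have hδ' : 0 < δ / (2 * (M + 1)) := by positivity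
  obtain ⟨ψ, hψc, hψs, hψ⟩ := (memLp_one_iff_integrable.2 hg).exist_eLpNorm_sub_le
    ENNReal.one_ne_top le_rfl hδ'
  have ht : IsTest ψ := ⟨hψs, hψc⟩
  have hd : ∫ x, ‖g x - ψ x‖ ≤ δ / (2 * (M + 1)) := by
    change ∫ x, ‖(g - ψ) x‖ ≤ _
    rw [integral_norm_eq_lintegral_enorm (hg.sub ht.integrable).aestronglyMeasurable]
    refine ENNReal.toReal_le_of_le_ofReal hδ'.le ?_
    rwa [eLpNorm_one_eq_lintegral_enorm] at hψ
  obtain ⟨N, hN⟩ := Metric.tendsto_atTop.1 (tendsto_integral_test_mul h hε hu i v ht) (δ / 2)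
    (by positivity)
  refine ⟨N, fun ν hν => ?_⟩
  have h1 := hN ν hν
  rw [dist_zero_right] at h1 ⊢
  have hi1 := integrable_mul_form ht.integrable ((h ν).memLp_d volume) i v
  have hi2 := integrable_mul_form (hg.sub ht.integrable) ((h ν).memLp_d volume) i v
  have hsplit : ∫ x, g x * w ν x i v
      = (∫ x, ψ x * w ν x i v) + ∫ x, (g - ψ) x * w ν x i v := by
    rw [← integral_add hi1 hi2]
    exact integral_congr_ae (Eventually.of_forall fun x => by simp only [Pi.sub_apply]; ring)
  have h2 : ‖∫ x, (g - ψ) x * w ν x i v‖ ≤ δ / (2 * (M + 1)) * M := by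
    refine (norm_integral_le_of_norm_le ((hg.sub ht.integrable).norm.mul_const M)
      (Eventually.of_forall fun x => ?_)).trans ?_
    · rw [norm_mul]
      refine mul_le_mul_of_nonneg_left ?_ (norm_nonneg _)
      exact (norm_eval_le (w ν x) i v).trans
        (mul_le_mul_of_nonneg_right (hw ν x) (Finset.prod_nonneg fun _ _ => norm_nonneg _))
    · rw [integral_mul_const]
      exact mul_le_mul_of_nonneg_right hd hM0
  have h3 : δ / (2 * (M + 1)) * M ≤ δ / 2 := by
    rw [div_mul_eq_mul_div, div_le_div_iff₀ (by positivity) (by positivity)]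
    nlinarith
  rw [hsplit]
  calc _ ≤ _ := norm_add_le _ _
    _ < δ / 2 + δ / 2 := by linarith
    _ = δ := by ring

theorem weakStarTendstoLinfty_add {V : Type*} [NormedAddCommGroup V] [NormedSpace ℝ V]
    {Ω : Set (E n)} {v : ℕ → E n → V} {v₀ : E n → V} (h₀ : MemLp v₀ ∞ (volume.restrict Ω))
    (hv : ∀ ν, MemLp (v ν) ∞ (volume.restrict Ω))
    (h : ∀ g : E n → (V →L[ℝ] ℝ), IntegrableOn g Ω →
      Tendsto (fun ν => ∫ x in Ω, g x (v ν x)) atTop (𝓝 0)) :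
    WeakStarTendstoLinfty Ω (fun ν => v₀ + v ν) v₀ := by
  intro g hg
  have hint : ∀ F : E n → V, MemLp F ∞ (volume.restrict Ω) →
      Integrable (fun x => g x (F x)) (volume.restrict Ω) := by
    intro F hF
    refine memLp_one_iff_integrable.1 ?_
    exact (ContinuousLinearMap.id ℝ (V →L[ℝ] ℝ)).memLp_of_bilin 1
      (memLp_one_iff_integrable.2 hg) hF
  have e : ∀ ν, ∫ x in Ω, g x ((v₀ + v ν) x)
      = (∫ x in Ω, g x (v₀ x)) + ∫ x in Ω, g x (v ν x) := by
    intro ν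
    rw [← integral_add (hint _ h₀) (hint _ (hv ν))]
    simp
  simp only [e]
  simpa using (h g hg).const_add (∫ x in Ω, g x (v₀ x))

/-- A sequence of perturbations which tends to zero uniformly and has bounded exterior
derivatives tends to zero weakly-*. -/
theorem weakStarTendsto_addGlobal {Ω : Set (E n)} (u₀ : WdInfty Ω r) (hΩ : MeasurableSet Ω)
    (h : ∀ ν, IsGlobalPair (u ν) (w ν)) {ε : ℕ → ℝ}
    (hε : Tendsto ε atTop (𝓝 0)) (hu : ∀ ν x, ‖u ν x‖ ≤ ε ν) {C : ℝ} (hw : ∀ ν x, ‖w ν x‖ ≤ C)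
    (hu0 : ∀ ν x, x ∉ Ω → u ν x = 0) (hw0 : ∀ ν x, x ∉ Ω → w ν x = 0) :
    WdInfty.WeakStarTendsto (fun ν => u₀.addGlobal (h ν) (hu0 ν) (hw0 ν)) u₀ := by
  constructor
  · refine weakStarTendstoLinfty_add u₀.memLp_form (fun ν => (h ν).memLp_form _) fun g hg => ?_
    have hb : ∀ ν, ‖∫ x in Ω, g x (u ν x)‖ ≤ ε ν * ∫ x in Ω, ‖g x‖ := by
      intro ν
      rw [← integral_const_mul]
      refine norm_integral_le_of_norm_le (hg.norm.const_mul _) (Eventually.of_forall fun x => ?_)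
      rw [mul_comm]
      exact ((g x).le_opNorm _).trans (mul_le_mul_of_nonneg_left (hu ν x) (norm_nonneg _))
    refine squeeze_zero_norm hb ?_
    simpa using hε.mul_const (∫ x in Ω, ‖g x‖)
  · refine weakStarTendstoLinfty_add u₀.memLp_d (fun ν => (h ν).memLp_d _) fun g hg => ?_
    -- Expanding w ν in the frame turns the functional-valued g into the scalar weights g x (c p),
    -- cut off to Ω so that the whole-space lemma applies.
    obtain ⟨c, hc⟩ := exists_frame (n := n) (fun i => r i + 1)
    have hgc : ∀ p, Integrable (Ω.indicator fun x => g x (c p)) := by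
      intro p
      rw [integrable_indicator_iff hΩ]
      exact (ContinuousLinearMap.apply ℝ ℝ (c p)).integrable_comp hg
    have e : ∀ ν, ∫ x in Ω, g x (w ν x) = ∑ p : (Σ i, Fin (r i + 1) → Fin n),
        ∫ x, (Ω.indicator fun x => g x (c p)) x *
          w ν x p.1 (fun j => EuclideanSpace.basisFun (Fin n) ℝ (p.2 j)) := by
      intro ν
      rw [← integral_finsetSum _ fun p _ =>
        integrable_mul_form (hgc p) ((h ν).memLp_d volume) p.1 _, ← integral_indicator hΩ]
      refine integral_congr_ae (Eventually.of_forall fun x => ?_)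
      by_cases hx : x ∈ Ω
      · simp only [indicator_of_mem hx]
        conv_lhs => rw [hc (w ν x), map_sum]
        refine Finset.sum_congr rfl fun p _ => ?_
        rw [map_smul, smul_eq_mul, mul_comm]
      · simp [indicator_of_notMem hx]
    simp only [e]
    rw [← Finset.sum_const_zero (s := (Finset.univ : Finset (Σ i, Fin (r i + 1) → Fin n)))]
    exact tendsto_finsetSum _ fun p _ => tendsto_integral_mul_eval h hε hu hw p.1 _ (hgc p)

end WeakStar

/-! ### The lattice ℤⁿ, fractional parts and tilings -/

section Lattice

variable {n : ℕ}

/-- The standard basis of `ℝⁿ`. -/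
noncomputable abbrev stdBasis (n : ℕ) : Module.Basis (Fin n) ℝ (E n) :=
  (EuclideanSpace.basisFun (Fin n) ℝ).toBasis

/-- The lattice `ℤⁿ`. -/
noncomputable abbrev stdLattice (n : ℕ) : Submodule ℤ (E n) :=
  Submodule.span ℤ (Set.range (stdBasis n))

theorem stdBasis_repr (x : E n) (i : Fin n) : (stdBasis n).repr x i = x i := by
  simp [stdBasis]

theorem mem_fundamentalDomain_iff (x : E n) :
    x ∈ ZSpan.fundamentalDomain (stdBasis n) ↔ ∀ i, x i ∈ Ico (0 : ℝ) 1 := by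
  simp only [ZSpan.mem_fundamentalDomain, stdBasis_repr]

theorem unitCube_subset_fundamentalDomain :
    unitCube n ⊆ ZSpan.fundamentalDomain (stdBasis n) := fun x hx =>
  (mem_fundamentalDomain_iff x).2 fun i => Ioo_subset_Ico_self (hx i)

theorem unitCube_eq_preimage : unitCube n =
    (MeasurableEquiv.toLp 2 (Fin n → ℝ)).symm ⁻¹' (univ.pi fun _ => Ioo (0 : ℝ) 1) := by
  ext x; simp [unitCube]

theorem fundamentalDomain_eq_preimage : ZSpan.fundamentalDomain (stdBasis n) =
    (MeasurableEquiv.toLp 2 (Fin n → ℝ)).symm ⁻¹' (univ.pi fun _ => Ico (0 : ℝ) 1) := by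
  ext x; simp

theorem measurableSet_unitCube : MeasurableSet (unitCube n) := by
  rw [unitCube_eq_preimage]
  exact (MeasurableEquiv.measurable _)
    (MeasurableSet.univ_pi fun _ => measurableSet_Ioo)

theorem unitCube_ae_eq_fundamentalDomain :
    unitCube n =ᵐ[volume] ZSpan.fundamentalDomain (stdBasis n) := by
  rw [unitCube_eq_preimage, fundamentalDomain_eq_preimage]
  refine (EuclideanSpace.volume_preserving_symm_measurableEquiv_toLp
    (Fin n)).quasiMeasurePreserving.preimage_ae_eq ?_
  exact (Measure.univ_pi_Ioo_ae_eq_Icc (f := fun _ => (0 : ℝ)) (g := fun _ => 1)).trans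
    (Measure.univ_pi_Ico_ae_eq_Icc (f := fun _ => (0 : ℝ)) (g := fun _ => 1)).symm

theorem volume_unitCube : volume (unitCube n) = 1 := by
  rw [unitCube_eq_preimage, (EuclideanSpace.volume_preserving_symm_measurableEquiv_toLp
    (Fin n)).measure_preimage
      (MeasurableSet.univ_pi fun _ => measurableSet_Ioo).nullMeasurableSet]
  simp [Real.volume_pi_Ioo]

instance : IsProbabilityMeasure (volume.restrict (unitCube n)) :=
  ⟨by simp [volume_unitCube]⟩

/-- The fractional part on `ℝⁿ`. -/
noncomputable abbrev fractPart (x : E n) : E n := ZSpan.fract (stdBasis n) x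

theorem measurable_fractPart : Measurable (fractPart (n := n)) := by
  have : (fractPart (n := n)) = fun x => x - ∑ i, ((⌊x i⌋ : ℤ) : ℝ) • stdBasis n i := by
    funext x
    simp only [fractPart, ZSpan.fract_apply, ZSpan.floor, stdBasis_repr, Submodule.coe_sum]
    congr 1
    refine Finset.sum_congr rfl fun i _ => ?_
    rw [Submodule.coe_smul, Module.Basis.restrictScalars_apply, Int.cast_smul_eq_zsmul]
  rw [this]
  refine measurable_id.sub (Finset.measurable_sum _ fun i _ => Measurable.smul_const ?_ _)
  have : Measurable fun x : E n => ⌊x i⌋ := Int.measurable_floor.comp (by fun_prop)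
  exact (measurable_from_top (f := fun z : ℤ => (z : ℝ))).comp this

-- The half-open cell and its translate by c are both fundamental domains of ℤⁿ, so a periodic
-- function has the same integral over them; the open cube differs from the cell by a null set.
open scoped Pointwise in
theorem setIntegral_unitCube_fract {V : Type*} [NormedAddCommGroup V] [NormedSpace ℝ V]
    (g : E n → V) (c : E n) :
    ∫ y in unitCube n, g (fractPart (c + y)) = ∫ y in unitCube n, g y := by
  have hF := ZSpan.isAddFundamentalDomain' (stdBasis n) (volume : Measure (E n))
  have hm := ZSpan.fundamentalDomain_measurableSet (stdBasis n)
  have : Countable (stdLattice n).toAddSubgroup := inferInstanceAs (Countable (stdLattice n))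
  rw [setIntegral_congr_set unitCube_ae_eq_fundamentalDomain,
    setIntegral_congr_set unitCube_ae_eq_fundamentalDomain]
  have h1 : ∫ y in ZSpan.fundamentalDomain (stdBasis n), g (fractPart (c + y))
      = ∫ y in c +ᵥ ZSpan.fundamentalDomain (stdBasis n), g (fractPart y) := by
    have := (measurePreserving_add_left volume c).setIntegral_preimage_emb
      (measurableEmbedding_addLeft c) (fun y => g (fractPart y))
      (c +ᵥ ZSpan.fundamentalDomain (stdBasis n))
    rw [← this]
    congr 2
    ext x
    simp only [mem_preimage, mem_vadd_set_iff_neg_vadd_mem, vadd_eq_add, neg_add_cancel_left]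
  rw [h1, (hF.vadd_of_comm c).setIntegral_eq hF]
  · refine setIntegral_congr_fun hm fun x hx => ?_
    simp only [fractPart, ZSpan.fract_eq_self.2 hx]
  · intro z x
    simp only [fractPart]
    rw [AddSubgroup.vadd_def, vadd_eq_add, ZSpan.fract_zSpan_add _ _ z.2]

/-- The translated cubes are disjoint: x - z lies in the open cube only if z is the integer part of
x, so at most one term survives. Points on cell faces cause no exception because g vanishes there.
-/
theorem sum_lattice_translates {V : Type*} [AddCommMonoid V] {g : E n → V}
    (hg : ∀ x, x ∉ unitCube n → g x = 0) (Z : Finset (E n)) (hZ : ∀ z ∈ Z, z ∈ stdLattice n)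
    (x : E n) : ((ZSpan.floor (stdBasis n) x : E n) ∈ Z ∧
      ∑ z ∈ Z, g (x - z) = g (fractPart x)) ∨
      ((ZSpan.floor (stdBasis n) x : E n) ∉ Z ∧ ∑ z ∈ Z, g (x - z) = 0) := by
  have h0 : ∀ z ∈ Z, z ≠ (ZSpan.floor (stdBasis n) x : E n) → g (x - z) = 0 := by
    intro z hz hne
    refine hg _ fun hx => hne ?_
    have h1 := ZSpan.fract_eq_self.2 (unitCube_subset_fundamentalDomain hx)
    rw [sub_eq_add_neg, ZSpan.fract_add_ZSpan _ _ (neg_mem (hZ z hz)), ZSpan.fract_apply] at h1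
    have := sub_right_injective (b := x) (by simpa [sub_eq_add_neg] using h1 :
      x - (ZSpan.floor (stdBasis n) x : E n) = x - z)
    exact this.symm
  by_cases hx : (ZSpan.floor (stdBasis n) x : E n) ∈ Z
  · exact Or.inl ⟨hx, by rw [Finset.sum_eq_single_of_mem _ hx h0]; rfl⟩
  · exact Or.inr ⟨hx, Finset.sum_eq_zero fun z hz => h0 z hz fun h => hx (h ▸ hz)⟩

/-- The lattice points whose cells, after rescaling, are contained in `U`. -/
def innerCells (U : Set (E n)) (s : ℝ) (y : E n) : Set (E n) :=
  {z | z ∈ stdLattice n ∧ ∀ x, s • x + (y - z) ∈ unitCube n → x ∈ U}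

theorem unitCube_nonempty : (unitCube n).Nonempty :=
  ⟨WithLp.toLp 2 fun _ => (1 / 2 : ℝ), fun i => by norm_num⟩

theorem finite_innerCells {U : Set (E n)} (hU : Bornology.IsBounded U) {s : ℝ} (hs : s ≠ 0)
    (y : E n) : (innerCells U s y).Finite := by
  obtain ⟨d, hd⟩ := unitCube_nonempty (n := n)
  have hb : Bornology.IsBounded ((fun x => s • x + (y - d)) '' U) := by
    obtain ⟨C, hC⟩ := hU.exists_norm_le
    refine (Metric.isBounded_closedBall (x := (0 : E n)) (r := |s| * C + ‖y - d‖)).subset ?_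
    rintro _ ⟨x, hx, rfl⟩
    rw [mem_closedBall_zero_iff]
    refine norm_add_le_of_le ?_ le_rfl
    rw [norm_smul, Real.norm_eq_abs]
    exact mul_le_mul_of_nonneg_left (hC x hx) (abs_nonneg _)
  -- The point of the cell of z corresponding to d lies in U, which exhibits z in the bounded image
  -- of U.
  refine (ZSpan.setFinite_inter (stdBasis n) hb).subset fun z hz => ⟨?_, hz.1⟩
  refine ⟨s⁻¹ • (d - (y - z)), hz.2 _ ?_, ?_⟩
  · rwa [smul_inv_smul₀ hs, sub_add_cancel]
  · simp only [smul_inv_smul₀ hs]; abel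

/-- Rescaled copies of `(u, w)` in the cells that are contained in `U`. -/
theorem IsGlobalPair.exists_tiling {m : ℕ} {r : Fin m → ℕ} {u : E n → Forms n r}
    {w : E n → Forms n (fun i => r i + 1)} (h : IsGlobalPair u w)
    (hu0 : ∀ x, x ∉ unitCube n → u x = 0) (hw0 : ∀ x, x ∉ unitCube n → w x = 0)
    {Cu Cw R : ℝ} (hCu : ∀ x, ‖u x‖ ≤ Cu) (hCw : ∀ x, ‖w x‖ ≤ Cw)
    (hR : ∀ a ∈ ZSpan.fundamentalDomain (stdBasis n),
      ∀ b ∈ ZSpan.fundamentalDomain (stdBasis n), ‖a - b‖ < R)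
    {U : Set (E n)} (hU : Bornology.IsBounded U) {s : ℝ} (hs : 0 < s) (y : E n) :
    ∃ (u' : E n → Forms n r) (w' : E n → Forms n (fun i => r i + 1)), IsGlobalPair u' w' ∧
      (∀ x, x ∉ U → u' x = 0) ∧ (∀ x, x ∉ U → w' x = 0) ∧ (∀ x, ‖u' x‖ ≤ s⁻¹ * Cu) ∧
      (∀ x, ‖w' x‖ ≤ Cw) ∧
      (∀ x, Metric.ball x (s⁻¹ * R) ⊆ U → w' x = w (fractPart (s • x + y))) := by
  have hfin := finite_innerCells hU hs.ne' y
  set Z := hfin.toFinset with hZdef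
  have hZ : ∀ z, z ∈ Z ↔ z ∈ innerCells U s y := fun z => hfin.mem_toFinset
  have hZL : ∀ z ∈ Z, z ∈ stdLattice n := fun z hz => ((hZ z).1 hz).1
  have hCu0 : 0 ≤ Cu := (norm_nonneg _).trans (hCu 0)
  have hCw0 : 0 ≤ Cw := (norm_nonneg _).trans (hCw 0)
  have eu : ∀ x, (∑ z ∈ Z, fun x => s⁻¹ • u (s • x + (y - z))) x
      = s⁻¹ • ∑ z ∈ Z, u ((s • x + y) - z) := by
    intro x
    rw [Finset.sum_apply, Finset.smul_sum]
    simp only [add_sub_assoc]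
  have ew : ∀ x, (∑ z ∈ Z, fun x => w (s • x + (y - z))) x
      = ∑ z ∈ Z, w ((s • x + y) - z) := by
    intro x
    rw [Finset.sum_apply]
    simp only [add_sub_assoc]
  -- An inner cell has its open part in U. A point outside U attached to such a cell therefore sits
  -- on a face, where u and w vanish.
  have hcell : ∀ x, (ZSpan.floor (stdBasis n) (s • x + y) : E n) ∈ Z → x ∉ U →
      fractPart (s • x + y) ∉ unitCube n := by
    intro x hx hxU hf
    refine hxU (((hZ _).1 hx).2 x ?_)
    rw [← add_sub_assoc]
    exact hf
  refine ⟨∑ z ∈ Z, fun x => s⁻¹ • u (s • x + (y - z)), ∑ z ∈ Z, fun x => w (s • x + (y - z)),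
    IsGlobalPair.sum Z fun z _ => h.comp_affine hs.ne' _, ?_, ?_, ?_, ?_, ?_⟩
  · intro x hx
    rw [eu]
    rcases sum_lattice_translates hu0 Z hZL (s • x + y) with ⟨h1, h2⟩ | ⟨_, h2⟩
    · rw [h2, hu0 _ (hcell x h1 hx), smul_zero]
    · rw [h2, smul_zero]
  · intro x hx
    rw [ew]
    rcases sum_lattice_translates hw0 Z hZL (s • x + y) with ⟨h1, h2⟩ | ⟨_, h2⟩
    · rw [h2, hw0 _ (hcell x h1 hx)]
    · rw [h2]
  · intro x
    rw [eu, norm_smul, Real.norm_of_nonneg (inv_nonneg.2 hs.le)]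
    refine mul_le_mul_of_nonneg_left ?_ (inv_nonneg.2 hs.le)
    rcases sum_lattice_translates hu0 Z hZL (s • x + y) with ⟨_, h2⟩ | ⟨_, h2⟩
    · rw [h2]; exact hCu _
    · rw [h2, norm_zero]; exact hCu0
  · intro x
    rw [ew]
    rcases sum_lattice_translates hw0 Z hZL (s • x + y) with ⟨_, h2⟩ | ⟨_, h2⟩
    · rw [h2]; exact hCw _
    · rw [h2, norm_zero]; exact hCw0
  · intro x hx
    rw [ew]
    rcases sum_lattice_translates hw0 Z hZL (s • x + y) with ⟨_, h2⟩ | ⟨h1, _⟩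
    · exact h2
    -- R exceeds all distances within a unit cell, so the rescaled cell of x lies in the ball of
    -- radius s⁻¹ * R about x, hence in U.
    · refine absurd ((hZ _).2 ⟨(ZSpan.floor (stdBasis n) (s • x + y)).2, fun x' hx' => hx ?_⟩) h1
      have e := hR _ (unitCube_subset_fundamentalDomain hx') _
        (ZSpan.fract_mem_fundamentalDomain (stdBasis n) (s • x + y))
      have e2 : s • x' + (y - (ZSpan.floor (stdBasis n) (s • x + y) : E n))
          - ZSpan.fract (stdBasis n) (s • x + y) = s • (x' - x) := by
        rw [ZSpan.fract_apply, smul_sub]; abel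
      rw [e2, norm_smul, Real.norm_of_nonneg hs.le] at e
      rw [mem_ball_iff_norm, inv_mul_eq_div, lt_div_iff₀ hs, mul_comm]
      exact e

end Lattice

/-! ### Carathéodory functions -/

section Caratheodory

/-- For a simple u, the composition is a finite sum of functions f(·, z) cut off to fibres. Simple
approximations of a representative of u and continuity of f x give the general case. -/
theorem aemeasurable_comp_of_caratheodory {α X : Type*} [MeasurableSpace α] [MetricSpace X]
    {μ : Measure α} {f : α → X → ℝ} (hf : ∀ z, AEMeasurable (fun x => f x z) μ)
    (hc : ∀ᵐ x ∂μ, Continuous (f x)) {u : α → X} (hu : AEStronglyMeasurable u μ) :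
    AEMeasurable (fun x => f x (u x)) μ := by
  classical
  have hm := hu.stronglyMeasurable_mk
  refine aemeasurable_of_tendsto_metrizable_ae atTop (f := fun n x => f x (hm.approx n x)) ?_ ?_
  · intro n
    have e : (fun x => f x (hm.approx n x)) = fun x => ∑ z ∈ (hm.approx n).range,
        ((hm.approx n) ⁻¹' {z}).indicator (fun x => f x z) x := by
      funext x
      rw [Finset.sum_eq_single_of_mem _ (SimpleFunc.mem_range_self _ x)]
      · rw [indicator_of_mem (mem_preimage.2 (mem_singleton _))]
      · intro z _ hz
        exact indicator_of_notMem (fun h => hz (Eq.symm h)) _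
    rw [e]
    exact Finset.aemeasurable_fun_sum _ fun z _ =>
      (hf z).indicator ((hm.approx n).measurableSet_fiber z)
  · filter_upwards [hc, hu.ae_eq_mk] with x hx he
    rw [he]
    exact (hx.tendsto _).comp (hm.tendsto_approx x)

theorem exists_le_of_norm_le {X : Type*} [NormedAddCommGroup X] [ProperSpace X] {b : X → ℝ}
    (hb : Continuous b) (M : ℝ) : ∃ B : ℝ, ∀ z, ‖z‖ ≤ M → b z ≤ B := by
  obtain ⟨B, hB⟩ := (isCompact_closedBall (0 : X) M).bddAbove_image hb.continuousOn
  exact ⟨B, fun z hz => hB ⟨z, mem_closedBall_zero_iff.2 hz, rfl⟩⟩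

/-- Uniform continuity on a closed ball suffices. Neither sequence has to converge, which matters
for oscillating arguments. -/
theorem tendsto_sub_of_bounded {X : Type*} [NormedAddCommGroup X] [ProperSpace X] {g : X → ℝ}
    (hg : Continuous g) {p q : ℕ → X} {M : ℝ} (hp : ∀ ν, ‖p ν‖ ≤ M) (hq : ∀ ν, ‖q ν‖ ≤ M)
    (h : Tendsto (fun ν => p ν - q ν) atTop (𝓝 0)) :
    Tendsto (fun ν => g (p ν) - g (q ν)) atTop (𝓝 0) := by
  have hu := (isCompact_closedBall (0 : X) M).uniformContinuousOn_of_continuous hg.continuousOn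
  rw [Metric.uniformContinuousOn_iff] at hu
  rw [Metric.tendsto_atTop]
  intro ε hε
  obtain ⟨δ, hδ, H⟩ := hu ε hε
  obtain ⟨N, hN⟩ := Metric.tendsto_atTop.1 h δ hδ
  refine ⟨N, fun ν hν => ?_⟩
  have h1 := hN ν hν
  rw [dist_zero_right, ← dist_eq_norm] at h1
  have h2 := H _ (mem_closedBall_zero_iff.2 (hp ν)) _ (mem_closedBall_zero_iff.2 (hq ν)) h1
  rwa [dist_zero_right, ← dist_eq_norm]

end Caratheodory

/-! ### Averaging over the phase of an oscillation -/

section Averaging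

variable {n : ℕ} {Y : Type*} [NormedAddCommGroup Y] {μ : Measure (E n)}
  {F : E n → Y → ℝ} {A : E n → ℝ} {C : ℝ} {h : E n → Y}

theorem integrable_prod_of_caratheodory (hF : ∀ z, AEMeasurable (fun x => F x z) μ)
    (hc : ∀ᵐ x ∂μ, Continuous (F x)) (hA : Integrable A μ)
    (hFA : ∀ᵐ x ∂μ, ∀ z, ‖z‖ ≤ C → |F x z| ≤ A x) {q : E n × E n → Y}
    (hq : StronglyMeasurable q) (hqC : ∀ p, ‖q p‖ ≤ C) :
    Integrable (fun p : E n × E n => F p.1 (q p)) (μ.prod (volume.restrict (unitCube n))) := by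
  have hfst : Measure.QuasiMeasurePreserving Prod.fst
      (μ.prod (volume.restrict (unitCube n))) μ := Measure.quasiMeasurePreserving_fst
  refine Integrable.mono' (g := fun p => A p.1) (hA.comp_fst _) ?_ ?_
  · exact (aemeasurable_comp_of_caratheodory (f := fun p : E n × E n => F p.1)
      (fun z => (hF z).comp_quasiMeasurePreserving hfst) (hfst.ae hc)
      hq.aestronglyMeasurable).aestronglyMeasurable
  · filter_upwards [hfst.ae hFA] with p hp
    exact hp _ (hqC p)

theorem integrable_integral_unitCube [SFinite μ] (hF : ∀ z, AEMeasurable (fun x => F x z) μ)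
    (hc : ∀ᵐ x ∂μ, Continuous (F x)) (hA : Integrable A μ)
    (hFA : ∀ᵐ x ∂μ, ∀ z, ‖z‖ ≤ C → |F x z| ≤ A x) (hm : StronglyMeasurable h)
    (hC : ∀ x, ‖h x‖ ≤ C) : Integrable (fun x => ∫ y in unitCube n, F x (h y)) μ :=
  (integrable_prod_of_caratheodory hF hc hA hFA (q := fun p => h p.2)
    (hm.comp_measurable measurable_snd) fun p => hC p.2).integral_prod_left

/-- Some phase of the rescaled periodic extension of `h` is at least as good as the average. -/
theorem exists_phase_integral_le [SFinite μ] (hF : ∀ z, AEMeasurable (fun x => F x z) μ)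
    (hc : ∀ᵐ x ∂μ, Continuous (F x)) (hA : Integrable A μ)
    (hFA : ∀ᵐ x ∂μ, ∀ z, ‖z‖ ≤ C → |F x z| ≤ A x) (hm : StronglyMeasurable h)
    (hC : ∀ x, ‖h x‖ ≤ C) (s : ℝ) :
    ∃ y, ∫ x, F x (h (fractPart (s • x + y))) ∂μ ≤ ∫ x, (∫ y in unitCube n, F x (h y)) ∂μ := by
  have hG := integrable_prod_of_caratheodory hF hc hA hFA
    (q := fun p => h (fractPart (s • p.1 + p.2)))
    (hm.comp_measurable (measurable_fractPart.comp (by fun_prop))) fun p => hC _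
  obtain ⟨y, hy⟩ := exists_le_integral hG.integral_prod_right
  refine ⟨y, hy.trans_eq ?_⟩
  -- With x integrated last, the inner integral over the phase is independent of the shift s • x by
  -- periodicity.
  rw [← integral_integral_swap
    (f := fun x y => F x (h (fractPart (s • x + y)))) hG]
  congr 1
  funext x
  exact setIntegral_unitCube_fract (fun y => F x (h y)) (s • x)

end Averaging

/-- Outer regularity approximates a measurable set by open ones, and absolute continuity of the
integral makes the excess negligible; the inequality thus passes from open sets to measurable sets.
-/
theorem ae_le_of_forall_isOpen_setIntegral_le {n : ℕ} {Ω : Set (E n)} (hΩ : IsOpen Ω)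
    (hfin : volume Ω ≠ ∞) {H K : E n → ℝ}
    (hH : IntegrableOn H Ω) (hK : IntegrableOn K Ω)
    (h : ∀ U ⊆ Ω, IsOpen U → ∫ x in U, H x ≤ ∫ x in U, K x) :
    ∀ᵐ x ∂(volume.restrict Ω), H x ≤ K x := by
  have hD : Integrable (fun x => K x - H x) (volume.restrict Ω) := hK.sub hH
  suffices 0 ≤ᵐ[volume.restrict Ω] fun x => K x - H x by
    filter_upwards [this] with x hx using sub_nonneg.1 hx
  refine ae_nonneg_of_forall_setIntegral_nonneg hD fun s hs _ => ?_
  rw [Measure.restrict_restrict hs]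
  set S := s ∩ Ω
  have hS : MeasurableSet S := hs.inter hΩ.measurableSet
  have hSfin : volume S ≠ ∞ := measure_ne_top_of_subset inter_subset_right hfin
  have hpos : ∀ k : ℕ, ((k : ℝ≥0∞) + 1)⁻¹ ≠ 0 := fun k => by simp
  choose V hSV hVo hV using fun k : ℕ => S.exists_isOpen_lt_add hSfin (hpos k)
  have hsub : ∀ k, S ⊆ V k ∩ Ω := fun k => subset_inter (hSV k) inter_subset_right
  have hmeas : Tendsto (fun k => (volume.restrict Ω) ((V k ∩ Ω) \ S)) atTop (𝓝 0) := by
    refine tendsto_of_tendsto_of_tendsto_of_le_of_le tendsto_const_nhds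
      (ENNReal.tendsto_inv_nat_nhds_zero.comp (tendsto_add_atTop_nat 1)) (fun _ => zero_le) ?_
    intro k
    calc (volume.restrict Ω) ((V k ∩ Ω) \ S) ≤ volume ((V k ∩ Ω) \ S) :=
          Measure.restrict_apply_le _ _
      _ ≤ volume (V k \ S) := measure_mono (sdiff_subset_sdiff_left inter_subset_left)
      _ = volume (V k) - volume S := measure_sdiff (hSV k) hS.nullMeasurableSet hSfin
      _ ≤ ((k : ℝ≥0∞) + 1)⁻¹ := by
        rw [tsub_le_iff_left]; exact (hV k).le
      _ = _ := by simp
  have hlim := hD.tendsto_setIntegral_nhds_zero hmeas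
  have key : ∀ k, 0 ≤ (∫ x in S, (K x - H x)) +
      ∫ x in (V k ∩ Ω) \ S, (K x - H x) ∂(volume.restrict Ω) := by
    intro k
    have hi : IntegrableOn (fun x => K x - H x) (V k ∩ Ω) :=
      IntegrableOn.mono_set hD inter_subset_right
    have h1 := h (V k ∩ Ω) inter_subset_right ((hVo k).inter hΩ)
    have hmk : MeasurableSet ((V k ∩ Ω) \ S) :=
      ((hVo k).measurableSet.inter hΩ.measurableSet).diff hS
    rw [Measure.restrict_restrict hmk,
      inter_eq_left.2 (sdiff_subset.trans inter_subset_right), add_comm,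
      setIntegral_sdiff hS hi (hsub k), sub_add_cancel,
      integral_sub (hK.mono_set inter_subset_right) (hH.mono_set inter_subset_right)]
    linarith
  have := ge_of_tendsto' (hlim.const_add (∫ x in S, (K x - H x))) key
  simpa using this

/-! ### From weak gradients to weak exterior derivatives -/

section WeakGradient

variable {n m : ℕ} {V : Type*} [NormedAddCommGroup V] [NormedSpace ℝ V]

theorem IsTest.continuous_fderiv_apply {ψ : E n → ℝ} (hψ : IsTest ψ) (v : E n) :
    Continuous fun x => fderiv ℝ ψ x v :=
  (hψ.1.continuous_fderiv (by simp)).clm_apply continuous_const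

theorem integral_test_smul_fderiv {ψ : E n → ℝ} (hψ : IsTest ψ) {u : E n → V}
    (hu : ContDiff ℝ 1 u) (v : E n) :
    ∫ x, ψ x • fderiv ℝ u x v = - ∫ x, fderiv ℝ ψ x v • u x := by
  refine integral_smul_fderiv_eq_neg_fderiv_smul_of_integrable ?_ ?_ ?_
    (fun x _ => (hψ.1.differentiable (by simp)) x)
    (fun x _ => (hu.differentiable (by simp)) x)
  · exact ((hψ.continuous_fderiv_apply v).smul hu.continuous).integrable_of_hasCompactSupport
      ((hψ.2.fderiv_apply ℝ v).smul_right)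
  · exact (hψ.1.continuous.smul ((hu.continuous_fderiv (by simp)).clm_apply
      continuous_const)).integrable_of_hasCompactSupport hψ.2.smul_right
  · exact (hψ.1.continuous.smul hu.continuous).integrable_of_hasCompactSupport hψ.2.smul_right

/-- Integration by parts for a weak gradient gives integration by parts for the exterior
derivative. -/
theorem partsIdentity_of_weakGrad {r : Fin m → ℕ} {S : Set (E n)} {u : E n → Forms n r}
    {G : E n → (E n →L[ℝ] Forms n r)} (hu : MemLp u ∞ (volume.restrict S))
    (hG : ∀ v, MemLp (fun x => G x v) ∞ (volume.restrict S)) {ψ : E n → ℝ} (hψ : IsTest ψ)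
    (h : ∀ v : E n, ∫ x in S, ψ x • G x v = - ∫ x in S, fderiv ℝ ψ x v • u x) (i : Fin m) :
    PartsIdentity S (fun x => u x i) (fun x => ContinuousAlternatingMap.alternatizeUncurryFin
      ((ContinuousLinearMap.proj i).comp (G x))) ψ := by
  intro v
  have hi1 : ∀ j, Integrable (fun x => ψ x • G x (v j)) (volume.restrict S) := fun j =>
    hψ.integrable.restrict.smul_of_top_left (hG (v j))
  have hi2 : ∀ j, Integrable (fun x => fderiv ℝ ψ x (v j) • u x) (volume.restrict S) := fun j =>
    (hψ.integrable_fderiv (v j)).restrict.smul_of_top_left hu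
  have key : ∀ j : Fin (r i + 1), ∫ x in S, (evalForm r i (j.removeNth v)) (ψ x • G x (v j))
      = - ∫ x in S, (evalForm r i (j.removeNth v)) (fderiv ℝ ψ x (v j) • u x) := by
    intro j
    rw [ContinuousLinearMap.integral_comp_comm _ (hi1 j),
      ContinuousLinearMap.integral_comp_comm _ (hi2 j), h (v j), map_neg]
  calc _ = ∫ x in S, ∑ j : Fin (r i + 1),
        (-1 : ℝ) ^ (j : ℕ) * (evalForm r i (j.removeNth v)) (ψ x • G x (v j)) := by
        congr 1
        funext x
        rw [ContinuousAlternatingMap.alternatizeUncurryFin_apply, Finset.mul_sum]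
        refine Finset.sum_congr rfl fun j _ => ?_
        rw [map_smul, evalForm_apply, smul_eq_mul, zsmul_eq_mul]
        push_cast
        change ψ x * ((-1) ^ (j : ℕ) * G x (v j) i (j.removeNth v)) = _
        ring
    _ = ∑ j : Fin (r i + 1), (-1 : ℝ) ^ (j : ℕ) *
          ∫ x in S, (evalForm r i (j.removeNth v)) (ψ x • G x (v j)) := by
        rw [integral_finsetSum _ fun j _ =>
          (ContinuousLinearMap.integrable_comp _ (hi1 j)).const_mul _]
        simp only [integral_const_mul]
    _ = - ∑ j : Fin (r i + 1), (-1 : ℝ) ^ (j : ℕ) *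
          ∫ x in S, (evalForm r i (j.removeNth v)) (fderiv ℝ ψ x (v j) • u x) := by
        rw [← Finset.sum_neg_distrib]
        exact Finset.sum_congr rfl fun j _ => by rw [key j, mul_neg]
    _ = _ := by
        simp only [← integral_const_mul]
        rw [← integral_finsetSum _ fun j _ =>
          (ContinuousLinearMap.integrable_comp _ (hi2 j)).const_mul _]
        congr 2
        funext x
        refine Finset.sum_congr rfl fun j _ => ?_
        rw [map_smul, evalForm_apply, smul_eq_mul, mul_assoc]

end WeakGradient

/-! ### Affine forms with constant exterior derivative -/

section Primitive

variable {n m : ℕ} {r : Fin m → ℕ}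

/-- The linear primitive `x ↦ ι_x ξ / (r + 1)` of a constant form `ξ`. -/
noncomputable def primitive (ξ : Forms n (fun i => r i + 1)) : E n →L[ℝ] Forms n r :=
  ContinuousLinearMap.pi fun i => ((r i : ℝ) + 1)⁻¹ • (ξ i).curryLeft

theorem continuous_primitive_apply (x : E n) :
    Continuous fun ξ : Forms n (fun i => r i + 1) => primitive ξ x := by
  refine continuous_pi fun i => ?_
  have h : Continuous fun ξ : Forms n (fun i => r i + 1) => (ξ i).curryLeft x :=
    ((ContinuousAlternatingMap.curryLeftLI (𝕜 := ℝ) (E := E n) (F := ℝ)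
      (n := r i)).continuous.comp (continuous_apply i)).clm_apply continuous_const
  exact h.const_smul (((r i : ℝ) + 1)⁻¹)

/-- By antisymmetry each of the r i + 1 terms of the alternating sum equals ξ i, and the normalising
factor cancels their number. -/
theorem alternatize_primitive (ξ : Forms n (fun i => r i + 1)) (i : Fin m) :
    ContinuousAlternatingMap.alternatizeUncurryFin
      ((ContinuousLinearMap.proj i).comp (primitive ξ)) = ξ i := by
  have h : (ContinuousLinearMap.proj i).comp (primitive ξ)
      = ((r i : ℝ) + 1)⁻¹ • (ξ i).curryLeft := rfl
  rw [h, ContinuousAlternatingMap.alternatizeUncurryFin_smul ((r i : ℝ) + 1)⁻¹,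
    ContinuousAlternatingMap.alternatizeUncurryFin_curryLeft]
  ext v
  simp only [ContinuousAlternatingMap.smul_apply, smul_eq_mul, nsmul_eq_mul]
  push_cast
  rw [inv_mul_cancel_left₀ (by positivity)]

theorem memLp_affine {Ω : Set (E n)} (hΩ : IsOpen Ω) (hb : Bornology.IsBounded Ω)
    (ω₁ : Forms n r) (ξ : Forms n (fun i => r i + 1)) :
    MemLp (fun x => ω₁ + primitive ξ x) ∞ (volume.restrict Ω) := by
  obtain ⟨C, hC⟩ := hb.exists_norm_le
  refine memLp_top_of_bound (by fun_prop) (‖ω₁‖ + ‖primitive ξ‖ * C) ?_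
  filter_upwards [ae_restrict_mem hΩ.measurableSet] with x hx
  refine norm_add_le_of_le le_rfl (((primitive ξ).le_opNorm x).trans ?_)
  exact mul_le_mul_of_nonneg_left (hC x hx) (norm_nonneg _)

/-- The affine form `ω₁ + ι_x ξ / (r + 1)`, with exterior derivative `ξ`. -/
noncomputable def affineForm {Ω : Set (E n)} (hΩ : IsOpen Ω) (hb : Bornology.IsBounded Ω)
    (ω₁ : Forms n r) (ξ : Forms n (fun i => r i + 1)) : WdInfty Ω r where
  form x := ω₁ + primitive ξ x
  d _ := ξ
  memLp_form := memLp_affine hΩ hb ω₁ ξ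
  memLp_d := memLp_top_const ξ
  isWeak i ψ hψ hs := by
    have h := partsIdentity_of_weakGrad (u := fun x => ω₁ + primitive ξ x)
      (G := fun _ => primitive ξ) (S := Ω) (memLp_affine hΩ hb ω₁ ξ)
      (fun v => memLp_top_const (primitive ξ v)) hψ ?_ i
    · simpa only [alternatize_primitive] using h
    · intro v
      have h0 : ∀ x, x ∉ Ω → ψ x = 0 := fun x hx =>
        image_eq_zero_of_notMem_tsupport fun h => hx (hs h)
      have h1 : ∀ x, x ∉ Ω → fderiv ℝ ψ x = 0 := fun x hx =>
        fderiv_of_notMem_tsupport (𝕜 := ℝ) fun h => hx (hs h)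
      rw [setIntegral_eq_integral_of_forall_compl_eq_zero (fun x hx => by simp [h0 x hx]),
        setIntegral_eq_integral_of_forall_compl_eq_zero (fun x hx => by simp [h1 x hx])]
      have h2 := integral_test_smul_fderiv hψ (u := fun x => ω₁ + primitive ξ x)
        (contDiff_const.add (primitive ξ).contDiff) v
      simpa using h2

end Primitive

/-! ### Lower semicontinuity along tiled perturbations -/

/-- On bounded sets of arguments, `f` is dominated by an integrable function of `x`. -/
def DominatedOnBounded {n : ℕ} {X : Type*} [NormedAddCommGroup X] (Ω : Set (E n))
    (f : E n → X → ℝ) : Prop :=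
  ∀ M : ℝ, ∃ A : E n → ℝ, IntegrableOn A Ω ∧
    ∀ᵐ x ∂(volume.restrict Ω), ∀ z, ‖z‖ ≤ M → |f x z| ≤ A x

theorem integrable_comp_of_caratheodory {n : ℕ} {X : Type*} [NormedAddCommGroup X]
    {Ω S : Set (E n)} (hS : S ⊆ Ω) (hSm : MeasurableSet S) {f : E n → X → ℝ}
    (hf : IsCaratheodory Ω f) {A : E n → ℝ}
    (hA : IntegrableOn A Ω) {M : ℝ}
    (hfA : ∀ᵐ x ∂(volume.restrict Ω), ∀ z, ‖z‖ ≤ M → |f x z| ≤ A x) {v : E n → X}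
    (hv : AEStronglyMeasurable v (volume.restrict S)) (hvM : ∀ x ∈ S, ‖v x‖ ≤ M) :
    IntegrableOn (fun x => f x (v x)) S := by
  refine Integrable.mono' (hA.mono_set hS) ?_ ?_
  · exact (aemeasurable_comp_of_caratheodory
      (fun z => (hf.1 z).mono_measure (Measure.restrict_mono_set _ hS))
      (ae_restrict_of_ae_restrict_of_subset hS hf.2) hv).aestronglyMeasurable
  · filter_upwards [ae_restrict_of_ae_restrict_of_subset hS hfA, ae_restrict_mem hSm]
      with x hx hxS
    exact hx _ (hvM x hxS)

theorem WeakStarLSC.le_of_tendsto {n m : ℕ} {Ω : Set (E n)} {r : Fin m → ℕ}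
    {I : WdInfty Ω r → ℝ} (hI : WeakStarLSC I) {u : ℕ → WdInfty Ω r} {u₀ : WdInfty Ω r}
    (hu : WdInfty.WeakStarTendsto u u₀) {c : ℕ → ℝ} {L : ℝ} (hc : Tendsto c atTop (𝓝 L))
    (h : ∀ ν, I (u ν) ≤ c ν) : I u₀ ≤ L := by
  have h1 := hI u u₀ hu
  have h2 : liminf (fun ν => (I (u ν) : EReal)) atTop ≤ liminf (fun ν => (c ν : EReal)) atTop :=
    liminf_le_liminf (Eventually.of_forall fun ν => EReal.coe_le_coe_iff.2 (h ν))
  have h3 : liminf (fun ν => (c ν : EReal)) atTop = L :=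
    ((continuous_coe_real_ereal.tendsto L).comp hc).liminf_eq
  exact EReal.coe_le_coe_iff.1 (h1.trans (h2.trans h3.le))

/-- Lower semicontinuity along oscillating perturbations inside an open set `U`. -/
theorem setIntegral_le_setIntegral_average {n m : ℕ} {r : Fin m → ℕ} {Ω : Set (E n)}
    (hΩ : IsOpen Ω) (hΩb : Bornology.IsBounded Ω)
    {f : E n → Forms n r × Forms n (fun i => r i + 1) → ℝ} (hf : IsCaratheodory Ω f)
    (hdom : DominatedOnBounded Ω f) (hlsc : WeakStarLSC (energy Ω r f))
    {u : E n → Forms n r} {w : E n → Forms n (fun i => r i + 1)} (h : IsGlobalPair u w)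
    (hu0 : ∀ x, x ∉ unitCube n → u x = 0) (hw0 : ∀ x, x ∉ unitCube n → w x = 0)
    (ω₁ : Forms n r) (ξ₀ : Forms n (fun i => r i + 1)) :
    IntegrableOn (fun x => f x (ω₁ + primitive ξ₀ x, ξ₀)) Ω ∧
    IntegrableOn (fun x => ∫ y in unitCube n, f x (ω₁ + primitive ξ₀ x, ξ₀ + w y)) Ω ∧
    ∀ U ⊆ Ω, IsOpen U → ∫ x in U, f x (ω₁ + primitive ξ₀ x, ξ₀) ≤
      ∫ x in U, (∫ y in unitCube n, f x (ω₁ + primitive ξ₀ x, ξ₀ + w y)) := by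
  set ω : E n → Forms n r := fun x => ω₁ + primitive ξ₀ x with hω
  have hωc : Continuous ω := by fun_prop
  obtain ⟨Cu, hCu⟩ := h.bdd_form
  obtain ⟨Cw, hCw⟩ := h.bdd_d
  have hCu0 : 0 ≤ Cu := (norm_nonneg _).trans (hCu 0)
  have hCw0 : 0 ≤ Cw := (norm_nonneg _).trans (hCw 0)
  obtain ⟨Cω, hCω⟩ : ∃ C : ℝ, ∀ x ∈ Ω, ‖ω x‖ ≤ C := by
    obtain ⟨C, hC⟩ := hΩb.exists_norm_le
    refine ⟨‖ω₁‖ + ‖primitive ξ₀‖ * C, fun x hx => norm_add_le_of_le le_rfl ?_⟩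
    exact ((primitive ξ₀).le_opNorm x).trans (mul_le_mul_of_nonneg_left (hC x hx) (norm_nonneg _))
  -- M bounds every argument of f met below, so a single A dominates all the integrands.
  set M : ℝ := max (Cω + Cu) (‖ξ₀‖ + Cw) with hM
  obtain ⟨A, hA, hfA⟩ := hdom M
  have hMle : ∀ x ∈ Ω, ∀ p q, ‖p‖ ≤ Cu → ‖q‖ ≤ Cw → ‖(ω x + p, ξ₀ + q)‖ ≤ M := by
    intro x hx p q hp hq
    rw [Prod.norm_mk]
    exact max_le_max (norm_add_le_of_le (hCω x hx) hp) (norm_add_le_of_le le_rfl hq)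
  have hMle' : ∀ x ∈ Ω, ∀ q, ‖q‖ ≤ Cw → ‖(ω x, ξ₀ + q)‖ ≤ M := by
    intro x hx q hq
    simpa using hMle x hx 0 q (by simpa using hCu0) hq
  have hH : IntegrableOn (fun x => f x (ω x, ξ₀)) Ω :=
    integrable_comp_of_caratheodory subset_rfl hΩ.measurableSet hf hA hfA
      (hωc.prodMk continuous_const).aestronglyMeasurable fun x hx => by
        simpa using hMle' x hx 0 (by simpa using hCw0)
  have hF : ∀ z, AEMeasurable (fun x => f x (ω x, ξ₀ + z)) (volume.restrict Ω) := fun z =>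
    aemeasurable_comp_of_caratheodory hf.1 hf.2
      (hωc.prodMk continuous_const).aestronglyMeasurable
  have hFc : ∀ᵐ x ∂(volume.restrict Ω), Continuous fun z => f x (ω x, ξ₀ + z) := by
    filter_upwards [hf.2] with x hx
    exact hx.comp (by fun_prop)
  have hFA : ∀ᵐ x ∂(volume.restrict Ω), ∀ z, ‖z‖ ≤ Cw → |f x (ω x, ξ₀ + z)| ≤ A x := by
    filter_upwards [hfA, ae_restrict_mem hΩ.measurableSet] with x hx hxΩ z hz
    exact hx _ (hMle' x hxΩ z hz)
  have hK : IntegrableOn (fun x => ∫ y in unitCube n, f x (ω x, ξ₀ + w y)) Ω :=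
    integrable_integral_unitCube hF hFc hA hFA h.meas_d hCw
  refine ⟨hH, hK, fun U hUΩ hU => ?_⟩
  have hUm := hU.measurableSet
  obtain ⟨R, hR⟩ : ∃ R : ℝ, ∀ a ∈ ZSpan.fundamentalDomain (stdBasis n),
      ∀ b ∈ ZSpan.fundamentalDomain (stdBasis n), ‖a - b‖ < R := by
    obtain ⟨C, hC⟩ := (ZSpan.fundamentalDomain_isBounded (stdBasis n)).exists_norm_le
    refine ⟨C + C + 1, fun a ha b hb => ?_⟩
    linarith [norm_sub_le a b, hC a ha, hC b hb]
  set s : ℕ → ℝ := fun ν => (ν : ℝ) + 1 with hs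
  have hs0 : ∀ ν, 0 < s ν := fun ν => by positivity
  have hslim : Tendsto (fun ν => (s ν)⁻¹) atTop (𝓝 0) := by
    simpa [hs] using tendsto_one_div_add_atTop_nhds_zero_nat (𝕜 := ℝ)
  have hUrestr : volume.restrict U ≤ volume.restrict Ω := Measure.restrict_mono_set _ hUΩ
  choose y hy using fun ν => exists_phase_integral_le (μ := volume.restrict U)
    (fun z => (hF z).mono_measure hUrestr) (ae_restrict_of_ae_restrict_of_subset hUΩ hFc)
    (hA.mono_set hUΩ) (ae_restrict_of_ae_restrict_of_subset hUΩ hFA) h.meas_d hCw (s ν)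
  choose u' w' hpair hu'0 hw'0 hu'C hw'C hw'eq using fun ν =>
    h.exists_tiling hu0 hw0 hCu hCw hR (hΩb.subset hUΩ) (hs0 ν) (y ν)
  have hu'C' : ∀ ν x, ‖u' ν x‖ ≤ Cu := by
    intro ν x
    refine (hu'C ν x).trans (mul_le_of_le_one_left hCu0 (inv_le_one_of_one_le₀ ?_))
    simp [hs]
  have hlim : Tendsto (fun ν => (s ν)⁻¹ * Cu) atTop (𝓝 0) := by
    simpa using hslim.mul_const Cu
  -- q ν is the full periodic profile cut off sharply at ∂U. It is only a comparison field, and is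
  -- not claimed to be an exterior derivative; the phase choice controls its energy.
  set q : ℕ → E n → Forms n (fun i => r i + 1) := fun ν =>
    U.indicator fun x => w (fractPart (s ν • x + y ν)) with hq
  have hqm : ∀ ν, StronglyMeasurable (q ν) := fun ν =>
    (h.meas_d.comp_measurable (measurable_fractPart.comp
      (show Measurable fun x : E n => s ν • x + y ν by fun_prop))).indicator hUm
  have hqC : ∀ ν x, ‖q ν x‖ ≤ Cw := by
    intro ν x
    by_cases hx : x ∈ U
    · simp only [hq, indicator_of_mem hx]; exact hCw _
    · simp only [hq, indicator_of_notMem hx, norm_zero]; exact hCw0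
  have hΦ : ∀ ν, IntegrableOn (fun x => f x (ω x + u' ν x, ξ₀ + w' ν x)) Ω := fun ν =>
    integrable_comp_of_caratheodory subset_rfl hΩ.measurableSet hf hA hfA
      ((hωc.stronglyMeasurable.add (hpair ν).meas_form).prodMk
        (stronglyMeasurable_const.add (hpair ν).meas_d)).aestronglyMeasurable
      fun x hx => hMle x hx _ _ (hu'C' ν x) (hw'C ν x)
  have hΨ : ∀ ν, IntegrableOn (fun x => f x (ω x, ξ₀ + q ν x)) Ω := fun ν =>
    integrable_comp_of_caratheodory subset_rfl hΩ.measurableSet hf hA hfA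
      (hωc.stronglyMeasurable.prodMk
        (stronglyMeasurable_const.add (hqm ν))).aestronglyMeasurable
      fun x hx => hMle' x hx _ (hqC ν x)
  have herr : Tendsto (fun ν => ∫ x in Ω,
      (f x (ω x + u' ν x, ξ₀ + w' ν x) - f x (ω x, ξ₀ + q ν x))) atTop (𝓝 0) := by
    rw [← integral_zero (E n) ℝ (μ := volume.restrict Ω)]
    refine tendsto_integral_of_dominated_convergence (fun x => A x + A x)
      (fun ν => ((hΦ ν).sub (hΨ ν)).aestronglyMeasurable) (hA.add hA) ?_ ?_
    · intro ν
      filter_upwards [hfA, ae_restrict_mem hΩ.measurableSet] with x hx hxΩ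
      exact norm_sub_le_of_le (hx _ (hMle x hxΩ _ _ (hu'C' ν x) (hw'C ν x)))
        (hx _ (hMle' x hxΩ _ (hqC ν x)))
    · filter_upwards [hf.2, ae_restrict_mem hΩ.measurableSet] with x hx hxΩ
      refine tendsto_sub_of_bounded hx
        (fun ν => hMle x hxΩ _ _ (hu'C' ν x) (hw'C ν x))
        (fun ν => hMle' x hxΩ _ (hqC ν x)) ?_
      have hu'lim : Tendsto (fun ν => u' ν x) atTop (𝓝 0) :=
        squeeze_zero_norm (fun ν => hu'C ν x) hlim
      -- For x in U a small ball about x fits into U, and so eventually does its cell; outside U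
      -- both fields vanish.
      have hev : ∀ᶠ ν in atTop, w' ν x = q ν x := by
        by_cases hxU : x ∈ U
        · obtain ⟨δ, hδ, hball⟩ := Metric.isOpen_iff.1 hU x hxU
          have h1 : Tendsto (fun ν => (s ν)⁻¹ * R) atTop (𝓝 0) := by
            simpa using hslim.mul_const R
          filter_upwards [h1.eventually_lt_const hδ] with ν hν
          rw [hw'eq ν x ((Metric.ball_subset_ball hν.le).trans hball)]
          simp only [hq, indicator_of_mem hxU]
        · refine Eventually.of_forall fun ν => ?_
          rw [hw'0 ν x hxU]
          simp only [hq, indicator_of_notMem hxU]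
      refine Tendsto.congr' (f₁ := fun ν => (u' ν x, (0 : Forms n (fun i => r i + 1)))) ?_ ?_
      · filter_upwards [hev] with ν hν
        rw [hν, Prod.mk_sub_mk, add_sub_cancel_left, sub_self]
      · exact hu'lim.prodMk_nhds tendsto_const_nhds
  have hΨle : ∀ ν, ∫ x in Ω, f x (ω x, ξ₀ + q ν x) ≤ (∫ x in Ω, f x (ω x, ξ₀)) -
      (∫ x in U, f x (ω x, ξ₀)) + ∫ x in U, (∫ y in unitCube n, f x (ω x, ξ₀ + w y)) := by
    intro ν
    have h1 := setIntegral_sdiff hUm (hΨ ν) hUΩ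
    have h2 := setIntegral_sdiff hUm hH hUΩ
    have h3 : ∫ x in Ω \ U, f x (ω x, ξ₀ + q ν x) = ∫ x in Ω \ U, f x (ω x, ξ₀) :=
      setIntegral_congr_fun (hΩ.measurableSet.diff hUm) fun x hx => by
        simp only [hq, indicator_of_notMem hx.2, add_zero]
    have h4 : ∫ x in U, f x (ω x, ξ₀ + q ν x)
        = ∫ x in U, f x (ω x, ξ₀ + w (fractPart (s ν • x + y ν))) :=
      setIntegral_congr_fun hUm fun x hx => by simp only [hq, indicator_of_mem hx]
    have h5 := hy ν
    linarith
  -- The bound c ν consists of a constant and the error of `herr`. In the limit the energy of ω over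
  -- Ω appears on both sides and cancels, leaving the inequality on U.
  have hfinal := hlsc.le_of_tendsto
    (weakStarTendsto_addGlobal (affineForm hΩ hΩb ω₁ ξ₀) hΩ.measurableSet hpair hlim hu'C hw'C
      (fun ν x hx => hu'0 ν x fun hxU => hx (hUΩ hxU))
      (fun ν x hx => hw'0 ν x fun hxU => hx (hUΩ hxU)))
    (c := fun ν => ((∫ x in Ω, f x (ω x, ξ₀)) - (∫ x in U, f x (ω x, ξ₀)) +
      ∫ x in U, (∫ y in unitCube n, f x (ω x, ξ₀ + w y))) +
      ∫ x in Ω, (f x (ω x + u' ν x, ξ₀ + w' ν x) - f x (ω x, ξ₀ + q ν x)))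
    (by simpa using herr.const_add _) (by
      intro ν
      have h1 := integral_sub (hΦ ν) (hΨ ν)
      have h2 := hΨle ν
      change ∫ x in Ω, f x (ω x + u' ν x, ξ₀ + w' ν x) ≤ _
      linarith)
  change ∫ x in Ω, f x (ω x, ξ₀) ≤ _ at hfinal
  linarith

/-- The quasiconvexity inequality for one test form, almost everywhere in `Ω`. -/
theorem ae_le_average {n m : ℕ} {r : Fin m → ℕ} {Ω : Set (E n)}
    (hΩ : IsOpen Ω) (hΩb : Bornology.IsBounded Ω)
    {f : E n → Forms n r × Forms n (fun i => r i + 1) → ℝ} (hf : IsCaratheodory Ω f)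
    (hdom : DominatedOnBounded Ω f) (hlsc : WeakStarLSC (energy Ω r f))
    {φ : WdInfty (unitCube n) r} (hφ : φ.ZeroTangential)
    (ω₁ : Forms n r) (ξ₀ : Forms n (fun i => r i + 1)) :
    ∀ᵐ x ∂(volume.restrict Ω), f x (ω₁ + primitive ξ₀ x, ξ₀) ≤
      ∫ y in unitCube n, f x (ω₁ + primitive ξ₀ x, ξ₀ + φ.d y) := by
  obtain ⟨u, w, h, hu0, hw0, hw⟩ := hφ.exists_extension measurableSet_unitCube
  obtain ⟨hH, hK, hUK⟩ :=
    setIntegral_le_setIntegral_average hΩ hΩb hf hdom hlsc h hu0 hw0 ω₁ ξ₀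
  filter_upwards [ae_le_of_forall_isOpen_setIntegral_le hΩ hΩb.measure_lt_top.ne hH hK hUK]
    with x hx
  refine hx.trans_eq (integral_congr_ae ?_)
  filter_upwards [hw] with y hy
  rw [hy]

/-! ### One null set for all test forms -/

theorem tendsto_setIntegral_of_tendsto {n : ℕ} {X Y : Type*} [NormedAddCommGroup X]
    [NormedAddCommGroup Y] [ProperSpace X] [ProperSpace Y] {g : X × Y → ℝ} (hg : Continuous g)
    {p : ℕ → X} {p₀ : X} (hp : Tendsto p atTop (𝓝 p₀)) {ξ : ℕ → Y} {ξ₀ : Y}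
    (hξ : Tendsto ξ atTop (𝓝 ξ₀)) {μ : Measure (E n)} [IsFiniteMeasure μ] {h : ℕ → E n → Y}
    {h₀ : E n → Y} (hm : ∀ j, AEStronglyMeasurable (h j) μ) {M : ℝ}
    (hM : ∀ j, ∀ᵐ y ∂μ, ‖h j y‖ ≤ M)
    (hh : ∀ᵐ y ∂μ, Tendsto (fun j => h j y) atTop (𝓝 (h₀ y))) :
    Tendsto (fun j => ∫ y, g (p j, ξ j + h j y) ∂μ) atTop (𝓝 (∫ y, g (p₀, ξ₀ + h₀ y) ∂μ)) := by
  obtain ⟨Cp, hCp⟩ := (Metric.isBounded_range_of_tendsto p hp).exists_norm_le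
  obtain ⟨Cξ, hCξ⟩ := (Metric.isBounded_range_of_tendsto ξ hξ).exists_norm_le
  obtain ⟨B, hB⟩ := exists_le_of_norm_le hg.norm (max Cp (Cξ + M))
  refine tendsto_integral_of_dominated_convergence (fun _ => B) (fun j => ?_)
    (integrable_const _) (fun j => ?_) ?_
  · exact hg.comp_aestronglyMeasurable
      (aestronglyMeasurable_const.prodMk (aestronglyMeasurable_const.add (hm j)))
  · filter_upwards [hM j] with y hy
    refine hB _ ?_
    rw [Prod.norm_mk]
    exact max_le_max (hCp _ (mem_range_self j))
      (norm_add_le_of_le (hCξ _ (mem_range_self j)) hy)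
  · filter_upwards [hh] with y hy
    exact (hg.tendsto _).comp (hp.prodMk_nhds (hξ.add hy))

/-- The quasiconvexity inequality on the unit cube, for all test forms simultaneously. -/
theorem ae_forall_le_average {n m : ℕ} {r : Fin m → ℕ} {Ω : Set (E n)}
    (hΩ : IsOpen Ω) (hΩb : Bornology.IsBounded Ω)
    {f : E n → Forms n r × Forms n (fun i => r i + 1) → ℝ} (hf : IsCaratheodory Ω f)
    (hdom : DominatedOnBounded Ω f) (hlsc : WeakStarLSC (energy Ω r f)) :
    ∀ᵐ x₀ ∂(volume.restrict Ω), ∀ (ω₀ : Forms n r) (ξ₀ : Forms n (fun i => r i + 1))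
      (φ : WdInfty (unitCube n) r), φ.ZeroTangential →
        f x₀ (ω₀, ξ₀) ≤ ∫ x in unitCube n, f x₀ (ω₀, ξ₀ + φ.d x) := by
  have : Fact ((1 : ℝ≥0∞) ≠ ∞) := ⟨ENNReal.one_ne_top⟩
  -- The derivatives of test forms are viewed in L¹, which is separable, unlike L^∞. Splitting by
  -- the sup bound N keeps approximating sequences uniformly bounded, as dominated convergence
  -- requires.
  let S : ℕ → Set ((Forms n r × Forms n (fun i => r i + 1)) ×
      Lp (Forms n (fun i => r i + 1)) 1 (volume.restrict (unitCube n))) := fun N =>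
    {p | ∃ φ : WdInfty (unitCube n) r, φ.ZeroTangential ∧
      (∀ᵐ y ∂(volume.restrict (unitCube n)), ‖φ.d y‖ ≤ N) ∧
      p.2 =ᵐ[volume.restrict (unitCube n)] φ.d}
  choose t htS htc ht using fun N =>
    (TopologicalSpace.IsSeparable.of_separableSpace (S N)).exists_countable_dense_subset
  have hae : ∀ N, ∀ᵐ x ∂(volume.restrict Ω), ∀ p ∈ t N, f x (p.1.1 + primitive p.1.2 x, p.1.2) ≤
      ∫ y in unitCube n, f x (p.1.1 + primitive p.1.2 x, p.1.2 + p.2 y) := by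
    intro N
    refine (ae_ball_iff (htc N)).2 fun p hp => ?_
    obtain ⟨φ, hφ, -, hpφ⟩ := htS N hp
    filter_upwards [ae_le_average hΩ hΩb hf hdom hlsc hφ p.1.1 p.1.2] with x hx
    refine hx.trans_eq (integral_congr_ae ?_)
    filter_upwards [hpφ] with y hy
    rw [hy]
  filter_upwards [ae_all_iff.2 hae, hf.2] with x hx hc ω₀ ξ₀ φ hφ
  obtain ⟨N, hN⟩ := exists_ae_norm_le φ.memLp_d
  have hφ1 : MemLp φ.d 1 (volume.restrict (unitCube n)) := φ.memLp_d.mono_exponent le_top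
  -- The shift makes the affine form take the value ω₀ at the point x.
  have hmem : ((ω₀ - primitive ξ₀ x, ξ₀), hφ1.toLp) ∈ closure (t N) :=
    ht N ⟨φ, hφ, hN, hφ1.coeFn_toLp⟩
  obtain ⟨p, hpt, hp⟩ := mem_closure_iff_seq_limit.1 hmem
  have hp2 : Tendsto (fun j => (p j).2) atTop (𝓝 hφ1.toLp) := (continuous_snd.tendsto _).comp hp
  obtain ⟨ns, hns, hlim⟩ := (tendstoInMeasure_of_tendsto_Lp hp2).exists_seq_tendsto_ae
  have hp1 : Tendsto (fun j => (p (ns j)).1) atTop (𝓝 (ω₀ - primitive ξ₀ x, ξ₀)) :=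
    ((continuous_fst.tendsto _).comp hp).comp hns.tendsto_atTop
  have hω : Tendsto (fun j => (p (ns j)).1.1) atTop (𝓝 (ω₀ - primitive ξ₀ x)) :=
    (continuous_fst.tendsto _).comp hp1
  have hξ : Tendsto (fun j => (p (ns j)).1.2) atTop (𝓝 ξ₀) := (continuous_snd.tendsto _).comp hp1
  have hq : Tendsto (fun j => (p (ns j)).1.1 + primitive (p (ns j)).1.2 x) atTop (𝓝 ω₀) := by
    simpa using hω.add (((continuous_primitive_apply x).tendsto ξ₀).comp hξ)
  have hlim' : ∀ᵐ y ∂(volume.restrict (unitCube n)),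
      Tendsto (fun j => (p (ns j)).2 y) atTop (𝓝 (φ.d y)) := by
    filter_upwards [hlim, hφ1.coeFn_toLp] with y hy hy'
    rwa [hy'] at hy
  have hbd : ∀ j, ∀ᵐ y ∂(volume.restrict (unitCube n)), ‖(p (ns j)).2 y‖ ≤ N := by
    intro j
    obtain ⟨φ', -, hφ'N, hφ'⟩ := htS N (hpt (ns j))
    filter_upwards [hφ'N, hφ'] with y h1 h2
    rwa [h2]
  have hR := tendsto_setIntegral_of_tendsto hc hq hξ
    (fun j => Lp.aestronglyMeasurable (p (ns j)).2) hbd hlim'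
  have hL := (hc.tendsto (ω₀, ξ₀)).comp (hq.prodMk_nhds hξ)
  exact le_of_tendsto_of_tendsto' hL hR fun j => hx N _ (hpt (ns j))

/-! ### Vanishing boundary values imply vanishing tangential part -/

section TestedGradient

variable {n : ℕ} {F : Type*} [NormedAddCommGroup F] [NormedSpace ℝ F]

theorem memLp_clm_apply {μ : Measure (E n)} {G : E n → (E n →L[ℝ] F)} (hG : MemLp G ∞ μ) (v : E n) :
    MemLp (fun x => G x v) ∞ μ :=
  (ContinuousLinearMap.apply ℝ F v).comp_memLp' hG

/-- A bounded weight and a bounded linear map preserve L¹ convergence. This serves both θ j → u and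
the convergence of the gradients. -/
theorem tendsto_integral_smul_of_eLpNorm {α H : Type*} [MeasurableSpace α] [NormedAddCommGroup H]
    [NormedSpace ℝ H] {μ : Measure α} {a : α → ℝ} (ha : AEStronglyMeasurable a μ) {C : ℝ}
    (hC : ∀ x, |a x| ≤ C) (L : H →L[ℝ] F) {V : ℕ → α → H} {V₀ : α → H}
    (hV : ∀ j, Integrable (V j) μ) (hV₀ : Integrable V₀ μ)
    (h : Tendsto (fun j => eLpNorm (fun x => V j x - V₀ x) 1 μ) atTop (𝓝 0)) :
    Tendsto (fun j => ∫ x, a x • L (V j x) ∂μ) atTop (𝓝 (∫ x, a x • L (V₀ x) ∂μ)) := by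
  have hi : ∀ W : α → H, Integrable W μ → Integrable (fun x => a x • L (W x)) μ := fun W hW =>
    (L.integrable_comp hW).bdd_smul C ha (Eventually.of_forall hC)
  refine tendsto_integral_of_L1' _ (hi _ hV₀).aestronglyMeasurable (Eventually.of_forall fun j => hi _ (hV j)) ?_
  have hle : ∀ j, eLpNorm ((fun x => a x • L (V j x)) - fun x => a x • L (V₀ x)) 1 μ
      ≤ ENNReal.ofReal (C * ‖L‖) * eLpNorm (fun x => V j x - V₀ x) 1 μ := by
    intro j
    refine eLpNorm_le_mul_eLpNorm_of_ae_le_mul (Eventually.of_forall fun x => ?_) 1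
    rw [Pi.sub_apply, ← smul_sub, ← map_sub, norm_smul, mul_assoc]
    exact mul_le_mul (hC x) (L.le_opNorm _) (norm_nonneg _) ((abs_nonneg _).trans (hC x))
  refine tendsto_of_tendsto_of_tendsto_of_le_of_le tendsto_const_nhds ?_ (fun _ => zero_le) hle
  simpa using ENNReal.Tendsto.const_mul h (Or.inr ENNReal.ofReal_ne_top)

/-- For functions in `W_0^{1,∞}`, integration by parts has no boundary term. -/
theorem MemW0.exists_weakGrad {Ω : Set (E n)} (hΩb : Bornology.IsBounded Ω) {u : E n → F}
    (h : MemW0 Ω u) :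
    ∃ G : E n → (E n →L[ℝ] F), (∀ v, MemLp (fun x => G x v) ∞ (volume.restrict Ω)) ∧
      ∀ ψ : E n → ℝ, IsTest ψ → ∀ v : E n,
        ∫ x in Ω, ψ x • G x v = - ∫ x in Ω, fderiv ℝ ψ x v • u x := by
  obtain ⟨hu, G, hG, -, θ, hθ, hθu, hθG⟩ := h
  have : IsFiniteMeasure (volume.restrict Ω) := ⟨by simpa using hΩb.measure_lt_top⟩
  refine ⟨G, fun v => memLp_clm_apply hG v, fun ψ hψ v => ?_⟩
  obtain ⟨C, hC⟩ := hψ.2.exists_bound_of_continuous hψ.1.continuous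
  obtain ⟨C', hC'⟩ := (hψ.2.fderiv_apply ℝ v).exists_bound_of_continuous
    (hψ.continuous_fderiv_apply v)
  have h1 := tendsto_integral_smul_of_eLpNorm (μ := volume.restrict Ω) (a := ψ)
    hψ.1.continuous.aestronglyMeasurable hC (ContinuousLinearMap.apply ℝ F v)
    (V := fun j => fderiv ℝ (θ j)) (V₀ := G)
    (fun j => (((hθ j).1.continuous_fderiv (by simp)).integrable_of_hasCompactSupport
      ((hθ j).2.1.fderiv ℝ)).restrict) (hG.integrable le_top) hθG
  have h2 := tendsto_integral_smul_of_eLpNorm (μ := volume.restrict Ω)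
    (a := fun x => fderiv ℝ ψ x v)
    (hψ.continuous_fderiv_apply v).aestronglyMeasurable hC' (ContinuousLinearMap.id ℝ F)
    (V := θ) (V₀ := u)
    (fun j => ((hθ j).1.continuous.integrable_of_hasCompactSupport (hθ j).2.1).restrict)
    (hu.integrable le_top) hθu
  -- For θ j, supported in Ω, the formula is classical integration by parts on ℝⁿ, whatever ψ does
  -- near ∂Ω.
  refine tendsto_nhds_unique h1 (h2.neg.congr fun j => ?_)
  have h0 : ∀ x, x ∉ Ω → θ j x = 0 := fun x hx =>
    image_eq_zero_of_notMem_tsupport fun h => hx ((hθ j).2.2 h)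
  have h0' : ∀ x, x ∉ Ω → fderiv ℝ (θ j) x = 0 := fun x hx =>
    fderiv_of_notMem_tsupport (𝕜 := ℝ) fun h => hx ((hθ j).2.2 h)
  simp only [ContinuousLinearMap.id_apply, ContinuousLinearMap.apply_apply]
  rw [setIntegral_eq_integral_of_forall_compl_eq_zero (fun x hx => by simp [h0 x hx]),
    setIntegral_eq_integral_of_forall_compl_eq_zero (fun x hx => by simp [h0' x hx])]
  exact (integral_test_smul_fderiv hψ ((hθ j).1.of_le (by exact_mod_cast le_top)) v).symm

end TestedGradient

/-- `W_0^{1,∞}` is contained in `W_T^{d,∞}`. -/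
theorem WdInfty.zeroTangential_of_memW0 {n m : ℕ} {Ω : Set (E n)} (hΩ : IsOpen Ω)
    (hΩb : Bornology.IsBounded Ω) {r : Fin m → ℕ} (φ : WdInfty Ω r) (h : MemW0 Ω φ.form) :
    φ.ZeroTangential := by
  have : IsFiniteMeasure (volume.restrict Ω) := ⟨by simpa using hΩb.measure_lt_top⟩
  obtain ⟨G, hG, hparts⟩ := h.exists_weakGrad hΩb
  have hpart : ∀ i ψ, IsTest ψ → PartsIdentity Ω (fun x => φ.form x i)
      (fun x => ContinuousAlternatingMap.alternatizeUncurryFin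
        ((ContinuousLinearMap.proj i).comp (G x))) ψ := fun i ψ hψ =>
    partsIdentity_of_weakGrad φ.memLp_form hG hψ (hparts ψ hψ) i
  intro i ψ hψ v
  set D : E n → ℝ := fun x => ContinuousAlternatingMap.alternatizeUncurryFin
        ((ContinuousLinearMap.proj i).comp (G x)) v with hD
  have hDi : Integrable D (volume.restrict Ω) := by
    have e : D = fun x => ∑ j : Fin (r i + 1),
        (-1 : ℝ) ^ (j : ℕ) * evalForm r i (j.removeNth v) (G x (v j)) := by
      funext x
      rw [hD]
      simp only [ContinuousAlternatingMap.alternatizeUncurryFin_apply]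
      refine Finset.sum_congr rfl fun j _ => ?_
      rw [zsmul_eq_mul]
      push_cast
      rfl
    rw [e]
    exact integrable_finsetSum _ fun j _ =>
      (ContinuousLinearMap.integrable_comp _ ((hG (v j)).integrable le_top)).const_mul _
  have hdi : Integrable (fun x => φ.d x i v) (volume.restrict Ω) :=
    (evalForm (fun i => r i + 1) i v).integrable_comp (φ.memLp_d.integrable le_top)
  -- φ.d and the alternatized gradient satisfy the same identity for test functions supported in Ω,
  -- so they agree almost everywhere; the boundary-free identity for D then transfers to φ.d.
  have hae : ∀ᵐ x, x ∈ Ω → φ.d x i v - D x = 0 := by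
    refine hΩ.ae_eq_zero_of_integral_contDiff_smul_eq_zero
      (IntegrableOn.locallyIntegrableOn (hdi.sub hDi)) fun g hg hgc hgs => ?_
    have ht : IsTest g := ⟨hg, hgc⟩
    have e1 := φ.isWeak i g ht hgs v
    have e2 := hpart i g ht v
    obtain ⟨C, hC⟩ := hgc.exists_bound_of_continuous hg.continuous
    have hi : ∀ W : E n → ℝ, Integrable W (volume.restrict Ω) →
        Integrable (fun x => g x * W x) (volume.restrict Ω) := fun W hW =>
      hW.bdd_mul hg.continuous.aestronglyMeasurable (Eventually.of_forall hC)
    rw [← setIntegral_eq_integral_of_forall_compl_eq_zero (s := Ω) fun x hx => by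
      rw [image_eq_zero_of_notMem_tsupport fun h => hx (hgs h), zero_smul]]
    simp only [smul_eq_mul, mul_sub]
    rw [integral_sub (hi _ hdi) (hi _ hDi), sub_eq_zero, e1]
    exact e2.symm
  have e2 := hpart i ψ hψ v
  rw [← e2]
  refine integral_congr_ae ?_
  filter_upwards [(ae_restrict_iff' hΩ.measurableSet).2 hae] with x hx
  rw [sub_eq_zero.1 hx]

/-- A global pair that vanishes outside `S`, as an element of `W_T^{d,∞}(S)`. -/
def IsGlobalPair.toWdInfty {n m : ℕ} {r : Fin m → ℕ} {u : E n → Forms n r}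
    {w : E n → Forms n (fun i => r i + 1)} (h : IsGlobalPair u w) {S : Set (E n)}
    (hu : ∀ x, x ∉ S → u x = 0) (hw : ∀ x, x ∉ S → w x = 0) : WdInfty S r where
  form := u
  d := w
  memLp_form := h.memLp_form _
  memLp_d := h.memLp_d _
  isWeak i ψ hψ _ := (partsIdentity_of_eq_zero (S := S) (u := fun x => u x i)
    (w := fun x => w x i) (fun x hx => congrFun (hu x hx) i)
    (fun x hx => congrFun (hw x hx) i)).1 (h.parts i ψ hψ)

theorem IsGlobalPair.toWdInfty_zeroTangential {n m : ℕ} {r : Fin m → ℕ} {u : E n → Forms n r}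
    {w : E n → Forms n (fun i => r i + 1)} (h : IsGlobalPair u w) {S : Set (E n)}
    (hu : ∀ x, x ∉ S → u x = 0) (hw : ∀ x, x ∉ S → w x = 0) :
    (h.toWdInfty hu hw).ZeroTangential := fun i ψ hψ =>
  (partsIdentity_of_eq_zero (S := S) (u := fun x => u x i)
    (w := fun x => w x i) (fun x hx => congrFun (hu x hx) i)
    (fun x hx => congrFun (hw x hx) i)).1 (h.parts i ψ hψ)

/-! ### From the unit cube to arbitrary bounded domains -/

/-- Every bounded set is mapped into the unit cube by some homothety. -/
theorem exists_affine_preimage_subset_unitCube {n : ℕ} {S : Set (E n)}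
    (hS : Bornology.IsBounded S) :
    ∃ (s : ℝ) (c : E n), 0 < s ∧ ∀ x, s • x + c ∈ S → x ∈ unitCube n := by
  obtain ⟨ρ, hρ0, hρ⟩ := hS.exists_pos_norm_le
  set e : E n := WithLp.toLp 2 fun _ => (1 / 2 : ℝ) with he
  -- With the centre e of the cube, s • x + c = s • (x - e); a norm at most ρ then forces ‖x - e‖ ≤
  -- ρ/(2ρ+1) < 1/2.
  refine ⟨2 * ρ + 1, -((2 * ρ + 1) • e), by positivity, fun x hx i => ?_⟩
  have h1 := hρ _ hx
  rw [← sub_eq_add_neg, ← smul_sub, norm_smul, Real.norm_of_nonneg (by positivity)] at h1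
  have h2 : ‖x - e‖ < 1 / 2 := by
    by_contra hcon
    push Not at hcon
    nlinarith
  have h3 := (PiLp.norm_apply_le (x - e) i).trans_lt h2
  have h4 : (x - e) i = x i - 1 / 2 := rfl
  rw [h4, Real.norm_eq_abs, abs_lt] at h3
  constructor <;> linarith [h3.1, h3.2]

/-- A continuous function that satisfies the quasiconvexity inequality on the unit cube is
vectorially ext. quasiconvex. -/
theorem vectExtQuasiconvex_of_unitCube {n m : ℕ} {r : Fin m → ℕ}
    {g : Forms n (fun i => r i + 1) → ℝ} (hg : Continuous g)
    (h : ∀ ξ, ∀ φ : WdInfty (unitCube n) r, φ.ZeroTangential →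
      g ξ ≤ ∫ x in unitCube n, g (ξ + φ.d x)) : VectExtQuasiconvex g := by
  refine ⟨?_, fun ξ => ?_, fun Ω hΩ hΩb hΩn ξ ω hω => ?_⟩
  · borelize (Forms n (fun i => r i + 1))
    exact hg.measurable
  · refine ⟨g ⁻¹' Metric.ball (g ξ) 1,
      hg.continuousAt.preimage_mem_nhds (Metric.ball_mem_nhds _ one_pos), |g ξ| + 1,
      fun η hη => ?_⟩
    have h1 : |g η - g ξ| < 1 := hη
    have h2 := abs_sub_abs_le_abs_sub (g η) (g ξ)
    linarith
  obtain ⟨u, w, hp, hu0, hw0, hw⟩ :=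
    (ω.zeroTangential_of_memW0 hΩ hΩb hω).exists_extension hΩ.measurableSet
  obtain ⟨s, c, hs, hsc⟩ := exists_affine_preimage_subset_unitCube hΩb
  have hp' := hp.comp_affine hs.ne' c
  have hu' : ∀ x, x ∉ unitCube n → s⁻¹ • u (s • x + c) = 0 := fun x hx => by
    rw [hu0 _ fun hxS => hx (hsc x hxS), smul_zero]
  have hw' : ∀ x, x ∉ unitCube n → w (s • x + c) = 0 := fun x hx =>
    hw0 _ fun hxS => hx (hsc x hxS)
  have key : g ξ ≤ ∫ x in unitCube n, g (ξ + w (s • x + c)) :=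
    h ξ _ (hp'.toWdInfty_zeroTangential hu' hw')
  obtain ⟨C, hC⟩ := hp.bdd_d
  obtain ⟨B, hB⟩ := exists_le_of_norm_le hg.norm (‖ξ‖ + C)
  have hint : ∀ (μ : Measure (E n)) [IsFiniteMeasure μ] (w' : E n → Forms n (fun i => r i + 1)),
      StronglyMeasurable w' → (∀ x, ‖w' x‖ ≤ C) → Integrable (fun x => g (ξ + w' x)) μ := by
    intro μ _ w' hm hwC
    refine Integrable.mono' (integrable_const B)
      (hg.comp_stronglyMeasurable (stronglyMeasurable_const.add hm)).aestronglyMeasurable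
      (Eventually.of_forall fun x => hB _ (norm_add_le_of_le le_rfl (hwC x)))
  have : IsFiniteMeasure (volume.restrict Ω) := ⟨by simpa using hΩb.measure_lt_top⟩
  -- After subtracting g ξ, both integrands vanish outside their domains, so both integrals extend
  -- to ℝⁿ and differ only by the positive Jacobian.
  have hcube : ∫ x in unitCube n, (g (ξ + w (s • x + c)) - g ξ)
      = (∫ x in unitCube n, g (ξ + w (s • x + c))) - g ξ := by
    rw [integral_sub (hint _ _ hp'.meas_d fun x => hC _) (integrable_const _)]
    simp
  have hΩi : ∫ x in Ω, (g (ξ + w x) - g ξ)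
      = (∫ x in Ω, g (ξ + w x)) - volume.real Ω * g ξ := by
    rw [integral_sub (hint _ _ hp.meas_d hC) (integrable_const _)]
    simp
  have hscale := integral_comp_affine (s := s) c fun x => g (ξ + w x) - g ξ
  rw [← setIntegral_eq_integral_of_forall_compl_eq_zero (s := unitCube n)
      (fun x hx => by rw [hw' x hx, add_zero, sub_self]),
    ← setIntegral_eq_integral_of_forall_compl_eq_zero (s := Ω) (f := fun x => g (ξ + w x) - g ξ)
      (fun x hx => by rw [hw0 x hx, add_zero, sub_self]), hcube, hΩi, smul_eq_mul] at hscale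
  have hpos : 0 < |(s ^ Module.finrank ℝ (E n))⁻¹| := by positivity
  have h1 : 0 ≤ (∫ x in Ω, g (ξ + w x)) - volume.real Ω * g ξ := by
    refine nonneg_of_mul_nonneg_right ?_ hpos
    rw [← hscale]
    linarith
  have hvol : 0 < volume.real Ω :=
    ENNReal.toReal_pos (hΩ.measure_pos volume hΩn).ne' hΩb.measure_lt_top.ne
  have h2 : ∫ x in Ω, g (ξ + ω.d x) = ∫ x in Ω, g (ξ + w x) := by
    refine integral_congr_ae ?_
    filter_upwards [hw] with x hx
    rw [hx]
  change g ξ ≤ (volume.real Ω)⁻¹ * ∫ x in Ω, g (ξ + ω.d x)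
  rw [h2, inv_mul_eq_div, le_div_iff₀ hvol]
  linarith

end ExtForms

/-! ### The necessary condition -/

theorem mainTheorem4 {n m : ℕ} (hm : 1 ≤ m) (r : Fin m → ℕ) (hr : ∀ i, r i + 1 ≤ n)
    (Ω : Set (ExtForms.E n)) (hΩ : IsOpen Ω) (hΩb : Bornology.IsBounded Ω)
    (f : ExtForms.E n → ExtForms.Forms n r × ExtForms.Forms n (fun i => r i + 1) → ℝ)
    (hf : ExtForms.IsCaratheodory Ω f)
    (a : ExtForms.E n → ℝ) (ha : Integrable a volume)
    (b : ExtForms.Forms n r × ExtForms.Forms n (fun i => r i + 1) → ℝ)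
    (hb : Continuous b) (hb0 : ∀ z, 0 ≤ b z)
    (hbound : ∀ᵐ x ∂(volume.restrict Ω), ∀ ω ξ, |f x (ω, ξ)| ≤ a x + b (ω, ξ))
    (hlsc : ExtForms.WeakStarLSC (ExtForms.energy Ω r f)) :
    (∀ᵐ x₀ ∂(volume.restrict Ω), ∀ (ω₀ : ExtForms.Forms n r)
      (ξ₀ : ExtForms.Forms n (fun i => r i + 1))
      (φ : ExtForms.WdInfty (ExtForms.unitCube n) r), φ.ZeroTangential →
        f x₀ (ω₀, ξ₀) ≤ ∫ x in ExtForms.unitCube n, f x₀ (ω₀, ξ₀ + φ.d x)) ∧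
    (∀ᵐ x ∂(volume.restrict Ω), ∀ ω : ExtForms.Forms n r,
      ExtForms.VectExtQuasiconvex (fun ξ => f x (ω, ξ))) := by
  have hdom : ExtForms.DominatedOnBounded Ω f := by
    intro M
    obtain ⟨B, hB⟩ := ExtForms.exists_le_of_norm_le hb M
    have : IsFiniteMeasure (volume.restrict Ω) := ⟨by simpa using hΩb.measure_lt_top⟩
    -- B bounds the continuous b on the compact ball of radius M; the growth condition enters only
    -- through this domination.
    refine ⟨fun x => a x + B, ha.restrict.add (integrable_const B), ?_⟩
    filter_upwards [hbound] with x hx z hz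
    exact (hx z.1 z.2).trans (by simpa using hB z hz)
  have hcube := ExtForms.ae_forall_le_average hΩ hΩb hf hdom hlsc
  refine ⟨hcube, ?_⟩
  filter_upwards [hcube, hf.2] with x hx hc ω
  exact ExtForms.vectExtQuasiconvex_of_unitCube (hc.comp (by fun_prop)) fun ξ φ hφ => hx ω ξ φ hφ
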